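/- Let $\mathcal D$ be an uncertain Markov chain: a finite state set $S$ with initial state $s_I$, finitely many real-valued uncontrollable parameters, a transition function $\mathcal P$ assigning to each pair of states a polynomial with rational coefficients in these parameters, a parameter space $\mathcal V$ such that for every $u\in\mathcal V$ the instantiation $\mathcal D[u]$ is a Markov chain, and a probability distribution $\mathbb P$ on $\mathcal V$. Let $G\subseteq S$ be a target set which, for every $u\in\mathcal V$, is reached in $\mathcal D[u]$ with probability $1$ from every state (so that the expected cost of reaching $G$ is well-defined), and let $\kappa\in\mathbb R$. Let $c(s)$, $s\in S$, be state costs that are affine functions of a vector $w\in\mathbb R^{W}$ of $W$ controllable cost parameters, which range over a closed convex set $A\subseteq\mathbb R^{W}$ (for instance $\mathbb R^W$, $\mathbb R^W_{\ge 0}$, or the set where all costs are nonnegative). Write $\mathcal D[u],w\models\varphi_c$ if the expected cost of reaching $G$ from $s_I$ in $\mathcal D[u]$ with costs $c(\cdot)(w)$ is at most $\kappa$, and let $F(w)=\mathbb P\{u\in\mathcal V:\mathcal D[u],w\models\varphi_c\}$ be the satisfaction probability. Let $K\ge W+1$ and let $u_1,\dots,u_K$ be drawn independently from $\mathbb P$.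 The scenario program $\mathcal L_c(u_1,\dots,u_K)$ has variables $\tau\in\mathbb R$, $w\in A$ and $c^{i}_s\in\mathbb R$ ($1\le i\le K$, $s\in S$) and reads: minimize $\tau$ subject to, for all $i$, $$c^i_{s_I}\le\tau,\qquad c^i_{s_I}\le\kappa,\qquad c^i_s=0\ (s\in G),\qquad c^i_s=c(s)(w)+\sum_{s'\in S}\mathcal P(s,s')[u_i]\,c^i_{s'}\ (s\in S\setminus G).$$ Fix any strictly convex function $g:\mathbb R^W\to\mathbb R$; if there are several optimal solutions, the one whose cost parameters $w$ minimize $g$ is chosen (a unique optimal solution is always the chosen one). Let $\nu\in[0,1)$ and $$\alpha_\nu=\sum_{i=0}^{W+1}\binom Ki(1-\nu)^{K-i}\nu^i .$$ Then, with probability at least $1-\alpha_\nu$ over the samples, the following holds: if $w^*$ is the cost parameter vector chosen by $\mathcal L_c(u_1,\dots,u_K)$, and thus $\mathcal D[u_i],w^*\models\varphi_c$ for all $i$, then $F(w^*)\ge 1-\nu$. -/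

import Mathlib

open MeasureTheory

noncomputable section

/-- The paths `s₀ s₁ … sₙ` that start in `s`, end in `G`, and avoid `G` before the last step. -/
def firstHitPaths {S : Type*} [Fintype S] (G : Set S) (s : S) (n : ℕ) :
    Finset (Fin (n + 1) → S) :=
  open Classical in
  Finset.univ.filter fun π =>
    π 0 = s ∧ π (Fin.last n) ∈ G ∧ ∀ i : Fin n, π i.castSucc ∉ G

/-- The probability of a finite path in the Markov chain with transition matrix `P`. -/
def pathProb {S : Type*} (P : Matrix S S ℝ) {n : ℕ} (π : Fin (n + 1) → S) : ℝ :=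
  ∏ i : Fin n, P (π i.castSucc) (π i.succ)

/-- The cost collected along a finite path before its last state. -/
def pathCost {S : Type*} (c : S → ℝ) {n : ℕ} (π : Fin (n + 1) → S) : ℝ :=
  ∑ i : Fin n, c (π i.castSucc)

/-- The probability that the Markov chain started in `s` eventually reaches `G`. -/
def reachProb {S : Type*} [Fintype S] (P : Matrix S S ℝ) (G : Set S) (s : S) : ℝ :=
  ∑' n : ℕ, ∑ π ∈ firstHitPaths G s n, pathProb P π

/-- The expected cost that the Markov chain started in `s` collects until it reaches `G`
(well-defined when `G` is reached with probability one). -/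
def expectedCost {S : Type*} [Fintype S] (P : Matrix S S ℝ) (c : S → ℝ) (G : Set S) (s : S) : ℝ :=
  ∑' n : ℕ, ∑ π ∈ firstHitPaths G s n, pathProb P π * pathCost c π

/-- A parametric Markov chain with states `S` and parameters `V`. -/
structure PMC (S V : Type*) where
  /-- the initial state -/
  init : S
  /-- the transition function -/
  trans : S → S → MvPolynomial V ℚ

/-- The transition matrix of the instantiated chain `D[u]`. -/
def PMC.inst {S V : Type*} (D : PMC S V) (u : V → ℝ) : Matrix S S ℝ :=
  Matrix.of fun s s' => MvPolynomial.aeval u (D.trans s s')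

/-- `u` is well-defined for `D` if `D[u]` is a Markov chain. -/
def PMC.WellDefined {S V : Type*} [Fintype S] (D : PMC S V) (u : V → ℝ) : Prop :=
  (∀ s s', D.inst u s s' ∈ Set.Icc (0 : ℝ) 1) ∧ ∀ s, ∑ s', D.inst u s s' = 1

/-- An uncertain Markov chain: a parametric Markov chain with a parameter space of well-defined
instantiations and a probability distribution over the parameter space. -/
structure UMC (S V : Type*) [Fintype S] extends PMC S V where
  /-- the parameter space -/
  paramSpace : Set (V → ℝ)
  wellDefined : ∀ u ∈ paramSpace, toPMC.WellDefined u
  /-- the distribution of the (uncontrollable) parameters -/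
  dist : Measure paramSpace
  isProbabilityMeasure : IsProbabilityMeasure dist

/-- The chain `D[u]` with the cost function `c` instantiated at the cost parameters `w` satisfies
the specification "the expected cost of reaching `G` is at most `κ`". -/
def UMC.Sat {S V W : Type*} [Fintype S] (D : UMC S V) (c : S → ((W → ℝ) →ᵃ[ℝ] ℝ))
    (G : Set S) (κ : ℝ) (w : W → ℝ) (u : D.paramSpace) : Prop :=
  reachProb (D.inst u) G D.init = 1 ∧ expectedCost (D.inst u) (fun s => c s w) G D.init ≤ κ

/-- The satisfaction probability of the expected cost specification at the cost parameters `w`. -/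
def UMC.satProb {S V W : Type*} [Fintype S] (D : UMC S V) (c : S → ((W → ℝ) →ᵃ[ℝ] ℝ))
    (G : Set S) (κ : ℝ) (w : W → ℝ) : ℝ :=
  ∫ u, Set.indicator {u | D.Sat c G κ w u} (fun _ => (1 : ℝ)) u ∂D.dist

/-- Feasibility of `(τ, w, x)` for the scenario program built from the samples `ω`; `A` is the
set of admissible cost parameters, and `x i s` is the cost variable of sample `i` at state `s`. -/
structure UMC.ScenarioFeasible {S V W : Type*} [Fintype S] (D : UMC S V)
    (c : S → ((W → ℝ) →ᵃ[ℝ] ℝ)) (G : Set S) (κ : ℝ) (A : Set (W → ℝ)) {K : ℕ}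
    (ω : Fin K → D.paramSpace) (τ : ℝ) (w : W → ℝ) (x : Fin K → S → ℝ) : Prop where
  admissible : w ∈ A
  le_bound : ∀ i, x i D.init ≤ τ
  le_threshold : ∀ i, x i D.init ≤ κ
  target : ∀ i, ∀ s ∈ G, x i s = 0
  step : ∀ i, ∀ s ∉ G, x i s = c s w + ∑ s', D.inst (ω i) s s' * x i s'

/-- Optimality of `(τ, w, x)`: it is feasible and minimizes `τ` among all feasible points. -/
def UMC.ScenarioOptimal {S V W : Type*} [Fintype S] (D : UMC S V)
    (c : S → ((W → ℝ) →ᵃ[ℝ] ℝ)) (G : Set S) (κ : ℝ) (A : Set (W → ℝ)) {K : ℕ}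
    (ω : Fin K → D.paramSpace) (τ : ℝ) (w : W → ℝ) (x : Fin K → S → ℝ) : Prop :=
  D.ScenarioFeasible c G κ A ω τ w x ∧
    ∀ τ' w' x', D.ScenarioFeasible c G κ A ω τ' w' x' → τ ≤ τ'

/-- `w` is the vector of cost parameters chosen by the scenario program: it belongs to an optimal
point, and ties between optimal points are broken by minimizing `g`. -/
def UMC.ScenarioSolution {S V W : Type*} [Fintype S] (D : UMC S V)
    (c : S → ((W → ℝ) →ᵃ[ℝ] ℝ)) (G : Set S) (κ : ℝ) (A : Set (W → ℝ)) (g : (W → ℝ) → ℝ) {K : ℕ}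
    (ω : Fin K → D.paramSpace) (w : W → ℝ) : Prop :=
  (∃ τ x, D.ScenarioOptimal c G κ A ω τ w x) ∧
    ∀ τ' w' x', D.ScenarioOptimal c G κ A ω τ' w' x' → g w ≤ g w'

/-- The confidence probability `α_ν` for `K` samples and `W` cost parameters. -/
def confidence (K W : ℕ) (ν : ℝ) : ℝ :=
  ∑ i ∈ Finset.range (W + 2), (K.choose i : ℝ) * (1 - ν) ^ (K - i) * ν ^ i

end

/-! The expected cost is the unique solution of the first-step equations
(`ReachesSurely.eq_expectedCost`), hence affine in `w`. The scenario program is therefore a min-max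
program over finitely many sampled convex functions, with optimal value `τ ≤ κ`. A parameter
violating the threshold `κ` at `w` also violates `τ`, so it suffices to bound the probability that
the set of parameters exceeding `τ` has mass more than `ν`.

For strictly convex constraints on a compact set, take `K + M` exchangeable samples and ask for how
many of their `K`-subsets `R` more than `J` of all the samples raise the optimal value of `R`. After
a generic perturbation, Helly's theorem shows that the active constraints of `R` number at most the
dimension plus one; padded to exactly `d` elements by means of a linear order, they form the only
`d`-subset of `R` whose violators `R` avoids. This uniqueness alone determines how many bases have a
given number of violators (`UniqueBases.card_eq`), so the count can be read off a model, the `d`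
largest elements of a linear order, where it is a hypergeometric tail
(`NondegenerateProgram.card_filter_violators_le`).

By exchangeability this bounds a probability (`choose_mul_measure_le`). If the violation probability
is at least `ν + t`, Chebyshev's inequality makes more than `νM` of the `M` fresh samples violators
with probability tending to one. As `M → ∞` the hypergeometric tail becomes the binomial tail, which
gives `measure_violationSet_le`.

Convex constraints are reduced to this case by adding `ε g` and intersecting `A` with a ball: as `ε
→ 0` the minimizers converge to the tie-broken one (`IsTieBrokenMinMax.tendsto`), and a liminf
argument carries the bound over. -/

/-- Every set with at least `d` elements contains exactly one `d`-element set `B` whose violator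
set `Z B` it avoids. -/
def UniqueBases {ι : Type*} (d : ℕ) (Z : Finset ι → Finset ι) : Prop :=
  ∀ R : Finset ι, d ≤ R.card → ∃! B : Finset ι, B.card = d ∧ B ⊆ R ∧ Disjoint R (Z B)

/-! ### Counting bases by their number of violators -/

section UniqueBases

open Finset

variable {ι : Type*} {d : ℕ} {Z Z' : Finset ι → Finset ι}

theorem UniqueBases.disjoint (h : UniqueBases d Z) {B : Finset ι} (hB : #B = d) :
    Disjoint B (Z B) := by
  obtain ⟨B', ⟨h1, h2, h3⟩, -⟩ := h B hB.ge
  obtain rfl := eq_of_subset_of_card_le h2 (by omega)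
  exact h3

variable [Fintype ι] [DecidableEq ι]

theorem card_powersetCard_between {B C : Finset ι} (hBC : Disjoint B C) {r : ℕ} (hr : #B ≤ r) :
    #{R ∈ powersetCard r (univ : Finset ι) | B ⊆ R ∧ Disjoint R C} =
      (Fintype.card ι - #B - #C).choose (r - #B) := by
  have hcard : #((B ∪ C)ᶜ) = Fintype.card ι - #B - #C := by
    rw [card_compl, card_union_of_disjoint hBC]; omega
  rw [← hcard, ← card_powersetCard]
  refine card_nbij' (fun R => R \ B) (fun T => T ∪ B) ?_ ?_ ?_ ?_
  · intro R hR
    simp only [mem_coe, mem_filter, mem_powersetCard, subset_univ, true_and] at hR ⊢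
    refine ⟨fun x hx => ?_, by rw [card_sdiff_of_subset hR.2.1, hR.1]⟩
    have := Finset.disjoint_left.1 hR.2.2
    grind [mem_compl]
  · intro T hT
    simp only [mem_coe, mem_filter, mem_powersetCard, subset_univ, true_and] at hT ⊢
    have hTB : Disjoint T B := by
      rw [Finset.disjoint_left]; intro x hx hx'
      have := hT.1 hx; grind [mem_compl]
    refine ⟨?_, subset_union_right, ?_⟩
    · rw [card_union_of_disjoint hTB]; omega
    · rw [disjoint_union_left]
      refine ⟨?_, hBC⟩
      rw [Finset.disjoint_left]; intro x hx hx'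
      have := hT.1 hx; grind [mem_compl]
  · intro R hR
    simp only [mem_coe, mem_filter] at hR
    exact sdiff_union_of_subset hR.2.1
  · intro T hT
    simp only [mem_coe, mem_powersetCard] at hT
    ext x
    have := @hT.1 x
    grind [mem_compl]

/-- Group the sets `R` by their unique basis `B`: such an `R` consists of `B` and `r - d` elements
chosen freely outside `B` and `Z B`. -/
theorem UniqueBases.card_filter (h : UniqueBases d Z) {r : ℕ} (hr : d ≤ r) (p : ℕ → Prop)
    [DecidablePred p] :
    #{R ∈ powersetCard r (univ : Finset ι) |
        ∃ B, #B = d ∧ B ⊆ R ∧ Disjoint R (Z B) ∧ p #(Z B)} =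
      ∑ j ∈ range (Fintype.card ι - d + 1), #{B : Finset ι | #B = d ∧ #(Z B) = j} *
        (if p j then (Fintype.card ι - d - j).choose (r - d) else 0) := by
  have hunion : {R ∈ powersetCard r (univ : Finset ι) |
        ∃ B, #B = d ∧ B ⊆ R ∧ Disjoint R (Z B) ∧ p #(Z B)} =
      ({B : Finset ι | #B = d ∧ p #(Z B)} : Finset (Finset ι)).biUnion fun B =>
        {R ∈ powersetCard r (univ : Finset ι) | B ⊆ R ∧ Disjoint R (Z B)} := by
    ext R
    simp only [mem_filter, mem_biUnion, mem_univ, true_and]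
    constructor
    · rintro ⟨hR, B, h1, h2, h3, h4⟩; exact ⟨B, ⟨h1, h4⟩, hR, h2, h3⟩
    · rintro ⟨B, ⟨h1, h4⟩, hR, h2, h3⟩; exact ⟨hR, B, h1, h2, h3, h4⟩
  rw [hunion, card_biUnion]
  · have hle : ∀ B ∈ ({B : Finset ι | #B = d} : Finset (Finset ι)),
        #(Z B) ∈ range (Fintype.card ι - d + 1) := by
      intro B hB
      simp only [mem_filter, mem_univ, true_and] at hB
      have := card_le_univ (B ∪ Z B)
      rw [card_union_of_disjoint (h.disjoint hB)] at this
      rw [mem_range]; omega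
    have h1 : ∑ B ∈ ({B : Finset ι | #B = d ∧ p #(Z B)} : Finset (Finset ι)),
          #{R ∈ powersetCard r (univ : Finset ι) | B ⊆ R ∧ Disjoint R (Z B)} =
        ∑ B ∈ ({B : Finset ι | #B = d} : Finset (Finset ι)),
          (if p #(Z B) then (Fintype.card ι - d - #(Z B)).choose (r - d) else 0) := by
      rw [← filter_filter, sum_filter]
      refine sum_congr rfl fun B hB => ?_
      simp only [mem_filter, mem_univ, true_and] at hB
      rw [card_powersetCard_between (h.disjoint hB) (by omega), hB]
    rw [h1, ← sum_fiberwise_of_maps_to hle]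
    refine sum_congr rfl fun j _ => ?_
    rw [filter_filter, sum_congr rfl (g := fun _ =>
      if p j then (Fintype.card ι - d - j).choose (r - d) else 0), sum_const, smul_eq_mul]
    intro B hB
    simp only [mem_filter, mem_univ, true_and] at hB
    rw [hB.2]
  · intro B hB B' hB' hne
    simp only [coe_filter, mem_univ, true_and, Set.mem_ofPred_eq] at hB hB'
    rw [Function.onFun, Finset.disjoint_left]
    intro R hR hR'
    simp only [mem_filter, mem_powersetCard] at hR hR'
    exact hne ((h R (by omega)).unique ⟨hB.1, hR.2⟩ ⟨hB'.1, hR'.2⟩)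

theorem UniqueBases.sum_eq (h : UniqueBases d Z) {r : ℕ} (hr : d ≤ r) :
    ∑ j ∈ range (Fintype.card ι - d + 1), #{B : Finset ι | #B = d ∧ #(Z B) = j} *
        (Fintype.card ι - d - j).choose (r - d) = (Fintype.card ι).choose r := by
  have := h.card_filter hr (fun _ => True)
  simp only [if_true, and_true] at this
  rw [← this, filter_true_of_mem, card_powersetCard, card_univ]
  intro R hR
  rw [mem_powersetCard] at hR
  exact (h R (by omega)).exists

/-- The identities `UniqueBases.sum_eq` form a triangular linear system in the counts, with ones on
the diagonal and data depending only on `d` and the size of the ground set, so its solution does not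
depend on `Z`. -/
theorem UniqueBases.card_eq (h : UniqueBases d Z) (h' : UniqueBases d Z') (j : ℕ)
    (hj : j ≤ Fintype.card ι - d) (hd : d ≤ Fintype.card ι) :
    #{B : Finset ι | #B = d ∧ #(Z B) = j} = #{B : Finset ι | #B = d ∧ #(Z' B) = j} := by
  induction j using Nat.strong_induction_on with
  | _ j ih =>
    have key : ∀ {Y : Finset ι → Finset ι}, UniqueBases d Y →
        ∑ i ∈ range j, #{B : Finset ι | #B = d ∧ #(Y B) = i} *
          (Fintype.card ι - d - i).choose (Fintype.card ι - j - d) +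
        #{B : Finset ι | #B = d ∧ #(Y B) = j} = (Fintype.card ι).choose (Fintype.card ι - j) := by
      intro Y hY
      -- For `r = card ι - j` the binomial coefficient vanishes at indices above `j` and equals one
      -- at `j`.
      rw [← hY.sum_eq (r := Fintype.card ι - j) (by omega),
        ← sum_subset (range_subset_range.2 (show j + 1 ≤ Fintype.card ι - d + 1 by omega)),
        sum_range_succ]
      · rw [show Fintype.card ι - j - d = Fintype.card ι - d - j by omega, Nat.choose_self, mul_one]
      · intro i _ hi
        rw [mem_range, not_lt] at hi
        rw [Nat.choose_eq_zero_of_lt (by grind), mul_zero]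
    have h1 := key h
    have h2 := key h'
    rw [sum_congr rfl (fun i hi => by
      rw [ih i (mem_range.1 hi) (by have := mem_range.1 hi; omega)])] at h1
    omega

theorem UniqueBases.card_filter_eq (h : UniqueBases d Z) (h' : UniqueBases d Z') {r : ℕ}
    (hr : d ≤ r) (hd : d ≤ Fintype.card ι) (p : ℕ → Prop) [DecidablePred p] :
    #{R ∈ powersetCard r (univ : Finset ι) |
        ∃ B, #B = d ∧ B ⊆ R ∧ Disjoint R (Z B) ∧ p #(Z B)} =
      #{R ∈ powersetCard r (univ : Finset ι) |
        ∃ B, #B = d ∧ B ⊆ R ∧ Disjoint R (Z' B) ∧ p #(Z' B)} := by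
  rw [h.card_filter hr, h'.card_filter hr]
  refine sum_congr rfl fun j hj => ?_
  rw [h.card_eq h' j (by have := mem_range.1 hj; omega) hd]

end UniqueBases

/-! ### The model: largest elements of a linear order -/

section Top

open Finset

variable {ι : Type*} [LinearOrder ι]

theorem existsUnique_top_subset (S : Finset ι) {m : ℕ} (hm : m ≤ #S) :
    ∃! T : Finset ι, #T = m ∧ T ⊆ S ∧ ∀ i ∈ S \ T, ∀ b ∈ T, i < b := by
  have hex : ∀ m ≤ #S, ∃ T : Finset ι, #T = m ∧ T ⊆ S ∧ ∀ i ∈ S \ T, ∀ b ∈ T, i < b := by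
    intro m
    induction m with
    | zero => exact fun _ => ⟨∅, by simp⟩
    | succ m ih =>
      intro hm
      obtain ⟨T, h1, h2, h3⟩ := ih (by omega)
      have hne : (S \ T).Nonempty := by
        rw [← card_pos, card_sdiff_of_subset h2]; omega
      obtain ⟨x, hx, hmax⟩ := exists_max_image (S \ T) id hne
      rw [mem_sdiff] at hx
      refine ⟨insert x T, by rw [card_insert_of_notMem hx.2, h1],
        insert_subset hx.1 h2, fun i hi b hb => ?_⟩
      simp only [mem_sdiff, mem_insert, not_or, id] at hi hb hmax
      obtain rfl | hb := hb
      · exact lt_of_le_of_ne (hmax i ⟨hi.1, hi.2.2⟩) hi.2.1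
      · exact h3 i (by simp [hi]) b hb
  obtain ⟨T, h1, h2, h3⟩ := hex m hm
  refine ⟨T, ⟨h1, h2, h3⟩, fun T' ⟨h1', h2', h3'⟩ => ?_⟩
  by_contra hne
  have e1 : ∃ x ∈ T', x ∉ T := by
    by_contra hcon; push Not at hcon
    exact hne (eq_of_subset_of_card_le hcon (by omega))
  have e2 : ∃ x ∈ T, x ∉ T' := by
    by_contra hcon; push Not at hcon
    exact hne (eq_of_subset_of_card_le hcon (by omega)).symm
  obtain ⟨x, hx, hxT⟩ := e1
  obtain ⟨y, hy, hyT⟩ := e2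
  exact lt_asymm (h3 x (by simp [h2' hx, hxT]) y hy) (h3' y (by simp [h2 hy, hyT]) x hx)

variable [Fintype ι]

/-- Avoiding these violators means that no element of `R` outside `B` lies above an element of `B`,
so `B` must be the top `d` elements of `R`. -/
theorem uniqueBases_top (d : ℕ) :
    UniqueBases d fun B : Finset ι => ({i | i ∉ B ∧ ∃ b ∈ B, b < i} : Finset ι) := by
  intro R hR
  have := existsUnique_top_subset R hR
  refine (existsUnique_congr fun B => ?_).1 this
  refine and_congr_right fun hB => and_congr_right fun hBR => ?_
  rw [Finset.disjoint_left]
  constructor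
  · intro h i hi hi'
    simp only [mem_filter, mem_univ, true_and] at hi'
    obtain ⟨hiB, b, hb, hbi⟩ := hi'
    exact lt_asymm hbi (h i (by simp [hi, hiB]) b hb)
  · intro h i hi b hb
    rw [mem_sdiff] at hi
    have := h hi.1
    simp only [mem_filter, mem_univ, true_and, not_and, not_exists, not_lt] at this
    exact lt_of_le_of_ne (this hi.2 b hb) (by rintro rfl; exact hi.2 hb)

theorem card_powersetCard_inter_lt (U : Finset ι) (N d : ℕ) (hd : d ≤ N + 1) :
    #{R ∈ powersetCard N (univ : Finset ι) | #(R ∩ U) < d} =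
      ∑ i ∈ range d, (#U).choose i * (Fintype.card ι - #U).choose (N - i) := by
  rw [card_eq_sum_card_fiberwise (f := fun R => #(R ∩ U)) (t := range d)
    (fun R hR => by simpa using (mem_filter.1 hR).2)]
  refine sum_congr rfl fun i hi => ?_
  rw [mem_range] at hi
  rw [← card_compl, ← card_powersetCard i, ← card_powersetCard (N - i), ← card_product]
  refine card_nbij' (fun R => (R ∩ U, R ∩ Uᶜ)) (fun T => T.1 ∪ T.2) ?_ ?_ ?_ ?_
  · intro R hR
    simp only [mem_coe, mem_filter, mem_powersetCard, subset_univ, true_and, mem_product] at hR ⊢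
    refine ⟨⟨inter_subset_right, hR.2⟩, inter_subset_right, ?_⟩
    have := card_inter_add_card_sdiff R U
    rw [← sdiff_eq_inter_compl]; omega
  · intro T hT
    simp only [mem_coe, mem_filter, mem_powersetCard, subset_univ, true_and, mem_product] at hT ⊢
    have hdis : Disjoint T.1 T.2 := by
      rw [Finset.disjoint_left]; intro x hx hx'
      have := hT.1.1 hx; have := hT.2.1 hx'; grind [mem_compl]
    have hU : (T.1 ∪ T.2) ∩ U = T.1 := by
      ext x
      have := @hT.1.1 x; have := @hT.2.1 x; grind [mem_compl]
    refine ⟨⟨?_, ?_⟩, ?_⟩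
    · rw [card_union_of_disjoint hdis]; omega
    · rw [hU]; omega
    · rw [hU]; omega
  · intro R _
    ext x; grind [mem_compl]
  · intro T hT
    simp only [mem_coe, mem_powersetCard, mem_product] at hT
    have h1 := hT.1.1
    have h2 := hT.2.1
    ext x
    · have := @h1 x; have := @h2 x; grind [mem_compl]
    · have := @h1 x; have := @h2 x; grind [mem_compl]

/-- In the model, with `U` the `J + d` largest elements of `ι`, the basis of `R` has more than `J`
violators exactly when `R` meets `U` in fewer than `d` points. -/
theorem UniqueBases.card_filter_lt {d : ℕ} {Z : Finset ι → Finset ι} (h : UniqueBases d Z)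
    {N J : ℕ} (hN : d ≤ N) (hJ : J + d ≤ Fintype.card ι) :
    #{R ∈ powersetCard N (univ : Finset ι) |
        ∃ B, #B = d ∧ B ⊆ R ∧ Disjoint R (Z B) ∧ J < #(Z B)} =
      ∑ i ∈ range d, (J + d).choose i * (Fintype.card ι - (J + d)).choose (N - i) := by
  rw [h.card_filter_eq (uniqueBases_top d) hN (by omega)]
  obtain ⟨U, ⟨hU, -, hUtop⟩, -⟩ :=
    existsUnique_top_subset (univ : Finset ι) (m := J + d) (by simpa using hJ)
  rw [← hU, ← card_powersetCard_inter_lt U N d (by omega)]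
  congr 1
  refine filter_congr fun R hR => ?_
  rw [mem_powersetCard] at hR
  have hup : ∀ i, i ∉ U → ∀ b ∈ U, i < b := fun i hi => hUtop i (by simp [hi])
  constructor
  · rintro ⟨B, hB, hBR, hdis, hlt⟩
    by_contra hcon
    rw [not_lt] at hcon
    -- An element of `B` outside `U` lies below all of `R ∩ U`, which would then belong to `B` and
    -- make `B` too large.
    have hBU : B ⊆ U := by
      intro b hb
      by_contra hbU
      have hsub : insert b (R ∩ U) ⊆ B := by
        refine insert_subset hb fun i hi => ?_
        rw [mem_inter] at hi
        by_contra hiB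
        exact Finset.disjoint_left.1 hdis hi.1 (by simpa [hiB] using ⟨b, hb, hup b hbU i hi.2⟩)
      have := card_le_card hsub
      rw [card_insert_of_notMem (by simp [hbU])] at this
      omega
    have hsub : ({i | i ∉ B ∧ ∃ b ∈ B, b < i} : Finset ι) ⊆ U \ B := by
      intro i hi
      simp only [mem_filter, mem_univ, true_and] at hi
      obtain ⟨hiB, b, hb, hbi⟩ := hi
      rw [mem_sdiff]
      refine ⟨?_, hiB⟩
      by_contra hiU
      exact lt_asymm hbi (hup i hiU b (hBU hb))
    have := card_le_card hsub
    rw [card_sdiff_of_subset hBU] at this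
    omega
  · intro hlt
    obtain ⟨B, ⟨hB, hBR, hdis⟩, -⟩ := uniqueBases_top d R (by omega)
    refine ⟨B, hB, hBR, hdis, ?_⟩
    have : ∃ b ∈ B, b ∉ U := by
      by_contra hcon
      push Not at hcon
      have := card_le_card (subset_inter hBR hcon)
      omega
    obtain ⟨b, hb, hbU⟩ := this
    -- Since `b` lies below all of `U`, the basis and its violators together have at least `J + d +
    -- 1` elements.
    have hsub : insert b U ⊆ ({i | i ∉ B ∧ ∃ b ∈ B, b < i} : Finset ι) ∪ B := by
      refine insert_subset (by simp [hb]) fun i hi => ?_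
      have := hup b hbU i hi
      simp only [mem_union, mem_filter, mem_univ, true_and]
      by_cases hiB : i ∈ B
      · exact Or.inr hiB
      · exact Or.inl ⟨hiB, b, hb, this⟩
    have := (card_le_card hsub).trans (card_union_le _ _)
    rw [card_insert_of_notMem hbU] at this
    omega

end Top

/-- The optimal value of the min-max program `min_{w ∈ A} max_{f ∈ F} f w`. -/
noncomputable def optVal {E : Type*} (A : Set E) (F : Set (E → ℝ)) : ℝ :=
  sInf {a | ∃ w ∈ A, ∀ f ∈ F, f w ≤ a}

/-- `w` is a minimizer of the min-max program `min_{w ∈ A} max_{f ∈ F} f w`. -/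
def IsMinMax {E : Type*} (A : Set E) (F : Set (E → ℝ)) (w : E) : Prop :=
  w ∈ A ∧ ∀ f ∈ F, f w ≤ optVal A F

/-! ### Min-max programs on a compact set -/

section OptVal

open Set

variable {E : Type*} [TopologicalSpace E] {A : Set E} {F G : Set (E → ℝ)}

theorem isLeast_optVal (hA : IsCompact A) (hne : A.Nonempty) (hF : F.Finite) (hFne : F.Nonempty)
    (hc : ∀ f ∈ F, ContinuousOn f A) :
    IsLeast {a | ∃ w ∈ A, ∀ f ∈ F, f w ≤ a} (optVal A F) := by
  have hne' : hF.toFinset.Nonempty := by simpa using hFne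
  have hcont : ContinuousOn (fun w => hF.toFinset.sup' hne' fun f => f w) A :=
    ContinuousOn.finset_sup'_apply hne' fun f hf => hc f (by simpa using hf)
  obtain ⟨w, hw, hmin⟩ := hA.exists_isMinOn hne hcont
  have hleast : IsLeast {a | ∃ w ∈ A, ∀ f ∈ F, f w ≤ a}
      (hF.toFinset.sup' hne' fun f => f w) := by
    refine ⟨⟨w, hw, fun f hf => Finset.le_sup' (fun f : E → ℝ => f w) (by simpa using hf)⟩, ?_⟩
    rintro a ⟨w', hw', h⟩
    exact (hmin hw').trans (Finset.sup'_le _ _ fun f hf => h f (by simpa using hf))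
  rw [optVal, hleast.csInf_eq]
  exact hleast

theorem exists_isMinMax (hA : IsCompact A) (hne : A.Nonempty) (hF : F.Finite) (hFne : F.Nonempty)
    (hc : ∀ f ∈ F, ContinuousOn f A) : ∃ w, IsMinMax A F w := by
  obtain ⟨w, hw, h⟩ := (isLeast_optVal hA hne hF hFne hc).1
  exact ⟨w, hw, h⟩

theorem optVal_le_iff (hA : IsCompact A) (hne : A.Nonempty) (hF : F.Finite) (hFne : F.Nonempty)
    (hc : ∀ f ∈ F, ContinuousOn f A) {a : ℝ} :
    optVal A F ≤ a ↔ ∃ w ∈ A, ∀ f ∈ F, f w ≤ a := by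
  refine ⟨fun h => ?_, fun h => (isLeast_optVal hA hne hF hFne hc).2 h⟩
  obtain ⟨w, hw, hw'⟩ := (isLeast_optVal hA hne hF hFne hc).1
  exact ⟨w, hw, fun f hf => (hw' f hf).trans h⟩

theorem optVal_lt_iff (hA : IsCompact A) (hne : A.Nonempty) (hF : F.Finite) (hFne : F.Nonempty)
    (hc : ∀ f ∈ F, ContinuousOn f A) {a : ℝ} :
    optVal A F < a ↔ ∃ w ∈ A, ∀ f ∈ F, f w < a := by
  constructor
  · intro h
    obtain ⟨w, hw, hw'⟩ := (isLeast_optVal hA hne hF hFne hc).1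
    exact ⟨w, hw, fun f hf => (hw' f hf).trans_lt h⟩
  · rintro ⟨w, hw, h⟩
    obtain ⟨f, hf, hmax⟩ := Set.exists_max_image F (fun f => f w) hF hFne
    exact ((optVal_le_iff hA hne hF hFne hc).2 ⟨w, hw, hmax⟩).trans_lt (h f hf)

theorem optVal_mono (hA : IsCompact A) (hne : A.Nonempty) (hG : G.Finite) (hFne : F.Nonempty)
    (hc : ∀ f ∈ G, ContinuousOn f A) (hFG : F ⊆ G) : optVal A F ≤ optVal A G := by
  rw [optVal_le_iff hA hne (hG.subset hFG) hFne fun f hf => hc f (hFG hf)]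
  obtain ⟨w, hw, h⟩ := (isLeast_optVal hA hne hG (hFne.mono hFG) hc).1
  exact ⟨w, hw, fun f hf => h f (hFG hf)⟩

/-- At the midpoint of two distinct minimizers every constraint would lie strictly below the optimal
value. -/
theorem IsMinMax.eq [AddCommGroup E] [Module ℝ E] (hA : IsCompact A) (hF : F.Finite)
    (hFne : F.Nonempty) (hc : ∀ f ∈ F, ContinuousOn f A) (hs : ∀ f ∈ F, StrictConvexOn ℝ A f)
    {w w' : E} (hw : IsMinMax A F w) (hw' : IsMinMax A F w') : w = w' := by
  by_contra hne
  have hlt : optVal A F < optVal A F := by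
    rw [optVal_lt_iff hA ⟨w, hw.1⟩ hF hFne hc]
    obtain ⟨f, hf⟩ := hFne
    refine ⟨(1 / 2 : ℝ) • w + (1 / 2 : ℝ) • w',
      (hs f hf).1 hw.1 hw'.1 (by norm_num) (by norm_num) (by norm_num), fun f hf => ?_⟩
    have := (hs f hf).2 hw.1 hw'.1 hne (show (0 : ℝ) < 1 / 2 by norm_num)
      (show (0 : ℝ) < 1 / 2 by norm_num) (by norm_num)
    have h1 := hw.2 f hf
    have h2 := hw'.2 f hf
    simp only [smul_eq_mul] at this
    linarith
  exact lt_irrefl _ hlt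

/-- If the value does not rise, a minimizer of the enlarged program also minimizes the old one, so
by uniqueness it is `w`. Violation thus becomes a test at a single point. -/
theorem IsMinMax.optVal_lt_insert_iff [AddCommGroup E] [Module ℝ E] (hA : IsCompact A)
    (hF : F.Finite) (hFne : F.Nonempty) (hc : ∀ f ∈ F, ContinuousOn f A)
    (hs : ∀ f ∈ F, StrictConvexOn ℝ A f) {g : E → ℝ} (hg : ContinuousOn g A) {w : E}
    (hw : IsMinMax A F w) : optVal A F < optVal A (insert g F) ↔ optVal A F < g w := by
  have hci : ∀ f ∈ insert g F, ContinuousOn f A := by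
    rintro f (rfl | hf)
    · exact hg
    · exact hc f hf
  rw [← not_iff_not, not_lt, not_lt,
    optVal_le_iff hA ⟨w, hw.1⟩ (hF.insert g) (insert_nonempty g F) hci]
  constructor
  · rintro ⟨w', hw', h⟩
    obtain rfl := hw.eq hA hF hFne hc hs ⟨hw', fun f hf => h f (mem_insert_of_mem _ hf)⟩
    exact h g (mem_insert g F)
  · intro h
    refine ⟨w, hw.1, ?_⟩
    rintro f (rfl | hf)
    · exact h
    · exact hw.2 f hf

end OptVal

/-! ### Generic perturbations by counting on a grid -/

section Perturbation

open Finset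

/-- On a grid with `M = card κ + 1` values per coordinate, the condition `k` excludes at most one
value of coordinate `i k` once the others are fixed. The conditions together exclude at most `card κ
* M ^ (card ι - 1)` points, fewer than the whole grid. -/
theorem exists_perturbation {ι κ : Type*} [Finite ι] [Finite κ] (i : κ → ι)
    (φ : κ → (ι → ℝ) → ℝ)
    (hφ : ∀ k η η', (∀ j, j ≠ i k → η j = η' j) → φ k η = φ k η') {δ : ℝ} (hδ : 0 < δ) :
    ∃ η : ι → ℝ, (∀ j, 0 ≤ η j ∧ η j < δ) ∧ ∀ k, η (i k) ≠ φ k η := by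
  classical
  cases nonempty_fintype ι
  cases nonempty_fintype κ
  rcases isEmpty_or_nonempty κ with hκ | ⟨⟨k₀⟩⟩
  · exact ⟨fun _ => 0, fun _ => ⟨le_rfl, hδ⟩, fun k => hκ.elim k⟩
  set M := Fintype.card κ + 1 with hM
  have hMpos : (0 : ℝ) < M := by positivity
  let grid : (ι → Fin M) → ι → ℝ := fun q j => δ * ((q j : ℕ) : ℝ) / M
  have hbad : ∀ k, #{q : ι → Fin M | grid q (i k) = φ k (grid q)} ≤
      M ^ (Fintype.card ι - 1) := by
    intro k
    have hcard : Fintype.card ({j // j ≠ i k} → Fin M) = M ^ (Fintype.card ι - 1) := by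
      rw [Fintype.card_fun, Fintype.card_fin, Fintype.card_subtype_compl,
        Fintype.card_subtype_eq]
    rw [← hcard, ← card_univ]
    refine card_le_card_of_injOn (fun q j => q j) (fun _ _ => mem_coe.2 (mem_univ _)) ?_
    intro q hq q' hq' hqq
    simp only [coe_filter, mem_univ, true_and, Set.mem_ofPred_eq] at hq hq'
    have hoff : ∀ j, j ≠ i k → q j = q' j := fun j hj => congrFun hqq ⟨j, hj⟩
    have hon : grid q (i k) = grid q' (i k) := by
      rw [hq, hq', hφ k (grid q) (grid q') fun j hj => by simp only [grid, hoff j hj]]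
    funext j
    by_cases hj : j = i k
    · subst hj
      have h1 : δ * ((q (i k) : ℕ) : ℝ) = δ * ((q' (i k) : ℕ) : ℝ) :=
        (div_left_inj' hMpos.ne').1 hon
      have h2 := mul_left_cancel₀ hδ.ne' h1
      exact Fin.ext (by exact_mod_cast h2)
    · exact hoff j hj
  have hpos : 0 < Fintype.card ι := Fintype.card_pos_iff.2 ⟨i k₀⟩
  have hlt : #((univ : Finset κ).biUnion fun k => {q : ι → Fin M | grid q (i k) = φ k (grid q)}) <
      #(univ : Finset (ι → Fin M)) := by
    calc _ ≤ Fintype.card κ * M ^ (Fintype.card ι - 1) := card_biUnion_le_card_mul _ _ _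
            fun k _ => hbad k
      _ < M * M ^ (Fintype.card ι - 1) := by
          refine Nat.mul_lt_mul_of_pos_right (by omega) (by positivity)
      _ = #(univ : Finset (ι → Fin M)) := by
          rw [← pow_succ', card_univ, Fintype.card_fun, Fintype.card_fin,
            Nat.sub_add_cancel hpos]
  obtain ⟨q, -, hq⟩ := exists_mem_notMem_of_card_lt_card hlt
  refine ⟨grid q, fun j => ⟨by positivity, ?_⟩, fun k hk => hq (by simpa using ⟨k, hk⟩)⟩
  rw [div_lt_iff₀ hMpos]
  exact mul_lt_mul_of_pos_left (by exact_mod_cast (q j).2) hδ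

end Perturbation

/-! ### Bases of strictly convex programs -/

section Violation

open Finset Filter Topology

variable {E : Type*} {A : Set E} {ι : Type*}

/-- The indices of the functions that raise the optimal value of the program given by `R`. -/
noncomputable def violators [Fintype ι] (A : Set E) (h : ι → E → ℝ) (R : Finset ι) : Finset ι :=
  open Classical in
  {i | optVal A (h '' R) < optVal A (insert (h i) (h '' R))}

/-- The indices in `R` of the functions that attain the optimal value at a minimizer. -/
noncomputable def activeSet (A : Set E) (h : ι → E → ℝ) (R : Finset ι) : Finset ι :=
  open Classical in
  {i ∈ R | ∃ w, IsMinMax A (h '' R) w ∧ h i w = optVal A (h '' R)}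

variable {h : ι → E → ℝ}

theorem isMinMax_of_subset {R B : Finset ι} {w : E} (hBR : B ⊆ R) (heq : optVal A (h '' B) = optVal A (h '' R))
    (hw : IsMinMax A (h '' R) w) : IsMinMax A (h '' B) w := by
  refine ⟨hw.1, ?_⟩
  rintro _ ⟨i, hi, rfl⟩
  rw [heq]
  exact hw.2 _ ⟨i, hBR hi, rfl⟩

theorem activeSet_subset {R : Finset ι} : activeSet A h R ⊆ R := by
  classical
  exact filter_subset _ _

variable [NormedAddCommGroup E] [NormedSpace ℝ E]

/-- A finite program with strictly convex continuous functions on a nonempty compact set, whose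
minimizers for subsets attain the optimal value at no further function. -/
structure NondegenerateProgram (A : Set E) (h : ι → E → ℝ) : Prop where
  compact : IsCompact A
  nonempty : A.Nonempty
  cont : ∀ i, ContinuousOn (h i) A
  convex : ∀ i, StrictConvexOn ℝ A (h i)
  ne_optVal : ∀ B : Finset ι, B.Nonempty → ∀ i ∉ B, ∀ w, IsMinMax A (h '' B) w →
    h i w ≠ optVal A (h '' B)

namespace NondegenerateProgram

variable {R B : Finset ι} {w w' : E}

theorem cont_image (H : NondegenerateProgram A h) (R : Finset ι) :
    ∀ f ∈ h '' (R : Set ι), ContinuousOn f A := by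
  rintro _ ⟨i, -, rfl⟩; exact H.cont i

theorem convex_image (H : NondegenerateProgram A h) (R : Finset ι) :
    ∀ f ∈ h '' (R : Set ι), StrictConvexOn ℝ A f := by
  rintro _ ⟨i, -, rfl⟩; exact H.convex i

theorem finite_image (_ : NondegenerateProgram A h) (R : Finset ι) : (h '' (R : Set ι)).Finite :=
  R.finite_toSet.image h

theorem exists_isMinMax (H : NondegenerateProgram A h) (hR : R.Nonempty) :
    ∃ w, IsMinMax A (h '' R) w :=
  _root_.exists_isMinMax H.compact H.nonempty (H.finite_image R) (hR.to_set.image h)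
    (H.cont_image R)

theorem eq (H : NondegenerateProgram A h) (hR : R.Nonempty) (hw : IsMinMax A (h '' R) w)
    (hw' : IsMinMax A (h '' R) w') : w = w' :=
  hw.eq H.compact (H.finite_image R) (hR.to_set.image h) (H.cont_image R) (H.convex_image R) hw'

theorem optVal_mono (H : NondegenerateProgram A h) (hB : B.Nonempty) (hBR : B ⊆ R) :
    optVal A (h '' B) ≤ optVal A (h '' R) :=
  _root_.optVal_mono H.compact H.nonempty (H.finite_image R) (hB.to_set.image h) (H.cont_image R)
    (Set.image_mono (by exact_mod_cast hBR))

theorem optVal_lt_iff (H : NondegenerateProgram A h) (hR : R.Nonempty) {a : ℝ} :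
    optVal A (h '' R) < a ↔ ∃ w ∈ A, ∀ i ∈ R, h i w < a := by
  rw [_root_.optVal_lt_iff H.compact H.nonempty (H.finite_image R) (hR.to_set.image h)
    (H.cont_image R)]
  simp

theorem mem_activeSet (H : NondegenerateProgram A h) (hR : R.Nonempty)
    (hw : IsMinMax A (h '' R) w) {i : ι} :
    i ∈ activeSet A h R ↔ i ∈ R ∧ h i w = optVal A (h '' R) := by
  simp only [activeSet, mem_filter]
  refine and_congr_right fun _ => ⟨?_, fun h' => ⟨w, hw, h'⟩⟩
  rintro ⟨w', hw', h'⟩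
  rwa [H.eq hR hw hw']

theorem mem_violators [Fintype ι] (H : NondegenerateProgram A h) (hR : R.Nonempty)
    (hw : IsMinMax A (h '' R) w) {i : ι} :
    i ∈ violators A h R ↔ optVal A (h '' R) < h i w := by
  simp only [violators, mem_filter, mem_univ, true_and]
  exact hw.optVal_lt_insert_iff H.compact (H.finite_image R) (hR.to_set.image h) (H.cont_image R)
    (H.convex_image R) (H.cont i)

theorem activeSet_nonempty (H : NondegenerateProgram A h) (hR : R.Nonempty) :
    (activeSet A h R).Nonempty := by
  obtain ⟨w, hw⟩ := H.exists_isMinMax hR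
  by_contra hcon
  rw [not_nonempty_iff_eq_empty] at hcon
  refine lt_irrefl (optVal A (h '' R)) ((H.optVal_lt_iff hR).2 ⟨w, hw.1, fun i hi => ?_⟩)
  refine lt_of_le_of_ne (hw.2 _ ⟨i, hi, rfl⟩) fun h' => ?_
  have := (H.mem_activeSet hR hw).2 ⟨hi, h'⟩
  simp [hcon] at this

/-- If the active constraints alone had a smaller value, a short step from the minimizer towards a
better point for them would lower every active constraint, while the inactive ones have slack; this
would beat the optimum of `R`. -/
theorem optVal_activeSet (H : NondegenerateProgram A h) (hR : R.Nonempty) :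
    optVal A (h '' activeSet A h R) = optVal A (h '' R) := by
  refine le_antisymm (H.optVal_mono (H.activeSet_nonempty hR) activeSet_subset) ?_
  by_contra! hlt
  obtain ⟨w, hw⟩ := H.exists_isMinMax hR
  obtain ⟨w', hw', hlt'⟩ := (H.optVal_lt_iff (H.activeSet_nonempty hR)).1 hlt
  set v := optVal A (h '' R) with hv
  have hev : ∀ᶠ t : ℝ in 𝓝[>] 0, ∀ i ∈ R, (1 - t) * h i w + t * h i w' < v := by
    rw [eventually_all_finset]
    intro i hi
    by_cases hact : h i w = v
    · have hi' := hlt' i ((H.mem_activeSet hR hw).2 ⟨hi, hact⟩)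
      filter_upwards [self_mem_nhdsWithin] with t ht
      have : 0 < t := ht
      rw [hact]; nlinarith
    · have hlt1 : h i w < v := lt_of_le_of_ne (hw.2 _ ⟨i, hi, rfl⟩) hact
      have hcont : Tendsto (fun t : ℝ => (1 - t) * h i w + t * h i w') (𝓝[>] 0)
          (𝓝 ((1 - 0) * h i w + 0 * h i w')) :=
        (Continuous.tendsto (by fun_prop) 0).mono_left nhdsWithin_le_nhds
      simp only [sub_zero, one_mul, zero_mul, add_zero] at hcont
      exact hcont.eventually_lt_const hlt1
  have hev1 : ∀ᶠ t : ℝ in 𝓝[>] 0, t ∈ Set.Ioc (0 : ℝ) 1 := Ioc_mem_nhdsGT one_pos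
  obtain ⟨t, ht, ht1⟩ := (hev.and hev1).exists
  obtain ⟨i₀, -⟩ := id hR
  refine lt_irrefl v ((H.optVal_lt_iff hR).2 ⟨(1 - t) • w + t • w', ?_, fun i hi => ?_⟩)
  · exact (H.convex i₀).1 hw.1 hw' (by linarith [ht1.2]) ht1.1.le (by ring)
  · exact ((H.convex i).convexOn.2 hw.1 hw' (by linarith [ht1.2]) ht1.1.le (by ring)).trans_lt
      (by simpa using ht i hi)

/-- By Helly's theorem applied to strict sublevel sets, some `B ⊆ R` with at most dimension plus one
elements already has the full value. Nondegeneracy forbids active indices outside `B`. -/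
theorem card_activeSet_le [FiniteDimensional ℝ E] (H : NondegenerateProgram A h)
    (hR : R.Nonempty) : #(activeSet A h R) ≤ Module.finrank ℝ E + 1 := by
  classical
  have hex : ∃ B ⊆ R, B.Nonempty ∧ #B ≤ Module.finrank ℝ E + 1 ∧
      optVal A (h '' B) = optVal A (h '' R) := by
    by_contra hcon
    push Not at hcon
    have := Convex.helly_theorem' (𝕜 := ℝ) (s := R)
      (F := fun i => {w | w ∈ A ∧ h i w < optVal A (h '' R)})
      (fun i _ => (H.convex i).convexOn.convex_lt _) (fun I hI hcard => by
        rcases I.eq_empty_or_nonempty with rfl | hne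
        · obtain ⟨w, hw⟩ := H.nonempty
          exact ⟨w, by simp⟩
        · have hlt := lt_of_le_of_ne (H.optVal_mono hne hI) (hcon I hI hne hcard)
          obtain ⟨w, hw, hw'⟩ := (H.optVal_lt_iff hne).1 hlt
          exact ⟨w, by simpa using fun i hi => ⟨hw, hw' i hi⟩⟩)
    obtain ⟨w, hw⟩ := this
    simp only [Set.mem_iInter, Set.mem_ofPred_eq] at hw
    obtain ⟨i, hi⟩ := id hR
    exact lt_irrefl _ ((H.optVal_lt_iff hR).2 ⟨w, (hw i hi).1, fun i hi => (hw i hi).2⟩)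
  obtain ⟨B, hBR, hBne, hcard, heq⟩ := hex
  refine (card_le_card fun i hi => ?_).trans hcard
  obtain ⟨w, hw⟩ := H.exists_isMinMax hR
  by_contra hiB
  refine H.ne_optVal B hBne i hiB w (isMinMax_of_subset hBR heq hw) ?_
  rw [heq]
  exact ((H.mem_activeSet hR hw).1 hi).2

variable [Fintype ι] [LinearOrder ι]

/-- Violators of a padded basis: those of the program, and the indices above a padding element. -/
noncomputable def paddedViolators (A : Set E) (h : ι → E → ℝ) (B : Finset ι) : Finset ι :=
  violators A h B ∪ ({i | i ∉ B ∧ ∃ b ∈ B \ activeSet A h B, b < i} : Finset ι)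

/-- The basis is the active set filled up with the largest other elements of `R`. Any competitor has
the same value and minimizer as `R`, so by nondegeneracy it contains the active set, and the order
condition then fixes its remaining elements. -/
theorem exists_padded_basis [FiniteDimensional ℝ E] (H : NondegenerateProgram A h) {d : ℕ}
    (hd : Module.finrank ℝ E + 1 ≤ d) (hR : d ≤ #R) :
    ∃ B : Finset ι, (#B = d ∧ B ⊆ R ∧ Disjoint R (paddedViolators A h B) ∧
        violators A h R ⊆ paddedViolators A h B) ∧
      ∀ B' : Finset ι, #B' = d ∧ B' ⊆ R ∧ Disjoint R (paddedViolators A h B') → B' = B := by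
  have hRne : R.Nonempty := card_pos.1 (by omega)
  have hact := H.card_activeSet_le hRne
  have hsub : activeSet A h R ⊆ R := activeSet_subset
  obtain ⟨w, hw⟩ := H.exists_isMinMax hRne
  obtain ⟨T, ⟨hT, hTR, hTtop⟩, hTuniq⟩ := existsUnique_top_subset (R \ activeSet A h R)
    (m := d - #(activeSet A h R)) (by rw [card_sdiff_of_subset hsub]; omega)
  have hdisj : Disjoint (activeSet A h R) T := by
    rw [Finset.disjoint_left]; intro x hx hxT
    exact (Finset.mem_sdiff.1 (hTR hxT)).2 hx
  set B := activeSet A h R ∪ T with hB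
  have hBne : B.Nonempty := (H.activeSet_nonempty hRne).mono subset_union_left
  have hBR : B ⊆ R := union_subset hsub (hTR.trans sdiff_subset)
  have heq : optVal A (h '' B) = optVal A (h '' R) := by
    refine le_antisymm (H.optVal_mono hBne hBR) ?_
    rw [← H.optVal_activeSet hRne]
    exact H.optVal_mono (H.activeSet_nonempty hRne) subset_union_left
  have hwB := isMinMax_of_subset hBR heq hw
  have hactB : activeSet A h B = activeSet A h R := by
    ext i
    rw [H.mem_activeSet hBne hwB, heq]
    constructor
    · rintro ⟨h1, h2⟩; exact (H.mem_activeSet hRne hw).2 ⟨hBR h1, h2⟩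
    · intro hi; exact ⟨subset_union_left hi, ((H.mem_activeSet hRne hw).1 hi).2⟩
  have hviol : violators A h R = violators A h B := by
    ext i; rw [H.mem_violators hBne hwB, H.mem_violators hRne hw, heq]
  refine ⟨B, ⟨?_, hBR, ?_, hviol ▸ subset_union_left⟩, ?_⟩
  · rw [hB, card_union_of_disjoint hdisj]; omega
  · rw [Finset.disjoint_left]
    intro i hi hi'
    rw [paddedViolators, mem_union, ← hviol, H.mem_violators hRne hw, hactB] at hi'
    rcases hi' with hi' | hi'
    · exact absurd (hw.2 _ ⟨i, hi, rfl⟩) (not_le.2 hi')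
    · simp only [mem_filter, mem_univ, true_and] at hi'
      obtain ⟨hiB, b, hb, hbi⟩ := hi'
      refine lt_asymm hbi (hTtop i ?_ b ?_)
      · simp only [Finset.mem_sdiff]
        simp only [hB, mem_union, not_or] at hiB
        exact ⟨⟨hi, hiB.1⟩, hiB.2⟩
      · simp only [hB, Finset.mem_sdiff, mem_union] at hb
        tauto
  · rintro B' ⟨hcard, hB'R, hdis⟩
    have hB'ne : B'.Nonempty := card_pos.1 (by omega)
    obtain ⟨w', hw'⟩ := H.exists_isMinMax hB'ne
    have hle : ∀ i ∈ R, h i w' ≤ optVal A (h '' B') := by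
      intro i hi
      have := Finset.disjoint_left.1 hdis hi
      rw [paddedViolators, mem_union, not_or, H.mem_violators hB'ne hw', not_lt] at this
      exact this.1
    have heq' : optVal A (h '' B') = optVal A (h '' R) := by
      refine le_antisymm (H.optVal_mono hB'ne hB'R) ?_
      rw [optVal_le_iff H.compact H.nonempty (H.finite_image R) (hRne.to_set.image h)
        (H.cont_image R)]
      exact ⟨w', hw'.1, by simpa using hle⟩
    have hwB' := isMinMax_of_subset hB'R heq' hw
    have hactsub : activeSet A h R ⊆ B' := by
      intro i hi
      by_contra hiB
      exact H.ne_optVal B' hB'ne i hiB w hwB' (by rw [heq', ((H.mem_activeSet hRne hw).1 hi).2])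
    have hactB' : activeSet A h B' = activeSet A h R := by
      ext i
      rw [H.mem_activeSet hB'ne hwB', heq']
      constructor
      · rintro ⟨h1, h2⟩; exact (H.mem_activeSet hRne hw).2 ⟨hB'R h1, h2⟩
      · intro hi; exact ⟨hactsub hi, ((H.mem_activeSet hRne hw).1 hi).2⟩
    have hTeq : B' \ activeSet A h R = T := by
      refine hTuniq _ ⟨by rw [card_sdiff_of_subset hactsub, hcard],
        sdiff_subset_sdiff hB'R le_rfl, fun i hi b hb => ?_⟩
      simp only [Finset.mem_sdiff, not_and, not_not] at hi
      have hiB' : i ∉ B' := fun hi' => hi.1.2 (hi.2 hi')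
      have := Finset.disjoint_left.1 hdis hi.1.1
      simp only [paddedViolators, mem_union, not_or, mem_filter, mem_univ, true_and, not_and,
        not_exists, not_lt, hactB'] at this
      refine lt_of_le_of_ne (this.2 hiB' b hb) ?_
      rintro rfl
      exact hiB' (Finset.mem_sdiff.1 hb).1
    rw [hB, ← hTeq, union_sdiff_of_subset hactsub]

theorem card_filter_violators_le [FiniteDimensional ℝ E] (H : NondegenerateProgram A h)
    {d N J : ℕ} (hd : Module.finrank ℝ E + 1 ≤ d) (hN : d ≤ N) (hJ : J + d ≤ Fintype.card ι) :
    #{R ∈ powersetCard N (univ : Finset ι) | J < #(violators A h R)} ≤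
      ∑ i ∈ range d, (J + d).choose i * (Fintype.card ι - (J + d)).choose (N - i) := by
  have hU : UniqueBases d (paddedViolators A h) := by
    intro R hR
    obtain ⟨B, ⟨h1, h2, h3, -⟩, h4⟩ := H.exists_padded_basis hd hR
    exact ⟨B, ⟨h1, h2, h3⟩, h4⟩
  rw [← hU.card_filter_lt hN hJ]
  refine card_le_card fun R hR => ?_
  rw [mem_filter, mem_powersetCard] at hR
  obtain ⟨B, ⟨h1, h2, h3, h4⟩, -⟩ := H.exists_padded_basis (R := R) hd (by omega)
  rw [mem_filter, mem_powersetCard]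
  exact ⟨hR.1, B, h1, h2, h3, hR.2.trans_le (card_le_card h4)⟩

end NondegenerateProgram

/-- For `i ∉ B` the minimizer and value of the program `B` do not depend on `η i`, so a coincidence
at `i` excludes just one value of `η i`. -/
theorem exists_nondegenerateProgram [Finite ι] (hA : IsCompact A) (hne : A.Nonempty)
    (hc : ∀ i, ContinuousOn (h i) A) (hs : ∀ i, StrictConvexOn ℝ A (h i)) {δ : ℝ} (hδ : 0 < δ) :
    ∃ η : ι → ℝ, (∀ j, 0 ≤ η j ∧ η j < δ) ∧
      NondegenerateProgram A fun i w => h i w + η i := by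
  let κ := {p : Finset ι × ι // p.1.Nonempty ∧ p.2 ∉ p.1}
  let F : κ → (ι → ℝ) → Set (E → ℝ) := fun k η => (fun i w => h i w + η i) '' (k.1.1 : Set ι)
  obtain ⟨w₀, -⟩ := id hne
  have : Nonempty E := ⟨w₀⟩
  -- Choosing a minimizer by `Classical.epsilon` makes the excluded value a function of `η`;
  -- uniqueness later identifies the choice with any given minimizer.
  obtain ⟨η, hη, hη'⟩ := exists_perturbation (fun k : κ => k.1.2)
    (fun k η => optVal A (F k η) - h k.1.2 (Classical.epsilon (IsMinMax A (F k η))))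
    (fun k η η' hk => by
      have : F k η = F k η' := Set.image_congr fun j hj => by
        rw [hk j (by rintro rfl; exact k.2.2 hj)]
      simp only [this]) hδ
  have hc' : ∀ i, ContinuousOn (fun w => h i w + η i) A := fun i =>
    (hc i).add continuousOn_const
  have hs' : ∀ i, StrictConvexOn ℝ A fun w => h i w + η i := fun i => (hs i).add_const (η i)
  refine ⟨η, hη, hA, hne, hc', hs', fun B hB i hi w hw heq => ?_⟩
  have h1 := hη' ⟨(B, i), hB, hi⟩
  have h2 : IsMinMax A ((fun i w => h i w + η i) '' (B : Set ι)) (Classical.epsilon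
      (IsMinMax A ((fun i w => h i w + η i) '' (B : Set ι)))) := Classical.epsilon_spec ⟨w, hw⟩
  have h3 : Classical.epsilon (IsMinMax A ((fun i w => h i w + η i) '' (B : Set ι))) = w := by
    refine h2.eq hA (B.finite_toSet.image _) (hB.to_set.image _) ?_ ?_ hw
    · rintro _ ⟨i, -, rfl⟩; exact hc' i
    · rintro _ ⟨i, -, rfl⟩; exact hs' i
  simp only [F, h3] at h1
  exact h1 (by rw [← heq]; ring)

/-- Degenerate programs reduce to the perturbed one: shifts smaller than every gap opened by a
violator lose no violators, so the count can only grow. -/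
theorem card_filter_violators_le [Fintype ι] [FiniteDimensional ℝ E] (hA : IsCompact A)
    (hne : A.Nonempty) (hc : ∀ i, ContinuousOn (h i) A) (hs : ∀ i, StrictConvexOn ℝ A (h i))
    {d N J : ℕ} (hd : Module.finrank ℝ E + 1 ≤ d) (hN : d ≤ N) (hJ : J + d ≤ Fintype.card ι) :
    #{R ∈ powersetCard N (univ : Finset ι) | J < #(violators A h R)} ≤
      ∑ i ∈ range d, (J + d).choose i * (Fintype.card ι - (J + d)).choose (N - i) := by
  have hgap : ∀ᶠ δ : ℝ in 𝓝[>] 0, ∀ R : Finset ι, ∀ i ∈ violators A h R,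
      optVal A (h '' R) + δ < optVal A (insert (h i) (h '' R)) := by
    rw [eventually_all]; intro R
    rw [eventually_all_finset]; intro i hi
    have hlt : optVal A (h '' R) < optVal A (insert (h i) (h '' R)) := by
      simpa [violators] using hi
    have hcont : Tendsto (fun δ : ℝ => optVal A (h '' R) + δ) (𝓝[>] 0)
        (𝓝 (optVal A (h '' R) + 0)) :=
      (Continuous.tendsto (by fun_prop) 0).mono_left nhdsWithin_le_nhds
    rw [add_zero] at hcont
    exact hcont.eventually_lt_const hlt
  obtain ⟨δ, hδ, hδ0⟩ := (hgap.and self_mem_nhdsWithin).exists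
  obtain ⟨η, hη, H⟩ := exists_nondegenerateProgram hA hne hc hs (δ := δ) hδ0
  -- An arbitrary order suffices, since it only serves to pad the bases.
  let _ : LinearOrder ι := LinearOrder.lift' (Fintype.equivFin ι) (Fintype.equivFin ι).injective
  refine le_trans (card_le_card fun R hR => ?_) (H.card_filter_violators_le hd hN hJ)
  rw [mem_filter, mem_powersetCard] at hR ⊢
  refine ⟨hR.1, hR.2.trans_le (card_le_card fun i hi => ?_)⟩
  have hRne : R.Nonempty := card_pos.1 (by omega)
  have hlt := hδ R i hi
  have hci : ∀ f ∈ insert (h i) (h '' (R : Set ι)), ContinuousOn f A := by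
    rintro _ (rfl | ⟨j, -, rfl⟩)
    · exact hc _
    · exact hc j
  obtain ⟨w, hw⟩ := exists_isMinMax hA hne (R.finite_toSet.image h) (hRne.to_set.image h)
    fun f hf => hci f (Set.mem_insert_of_mem _ hf)
  obtain ⟨v, hv⟩ := H.exists_isMinMax hRne
  rw [H.mem_violators hRne hv]
  by_contra! hcon
  -- If `i` did not violate the perturbed program, its minimizer `v` would be admissible for the
  -- enlarged original one because `η ≥ 0`; with `h2` the gap would be at most `δ`.
  have h1 : optVal A (insert (h i) (h '' (R : Set ι))) ≤
      optVal A ((fun i w => h i w + η i) '' (R : Set ι)) := by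
    rw [optVal_le_iff hA hne ((R.finite_toSet.image h).insert _) (Set.insert_nonempty _ _) hci]
    refine ⟨v, hv.1, ?_⟩
    rintro _ (rfl | ⟨j, hj, rfl⟩)
    · linarith [(hη i).1]
    · have := hv.2 _ ⟨j, hj, rfl⟩
      dsimp only at this
      linarith [(hη j).1]
  have h2 : optVal A ((fun i w => h i w + η i) '' (R : Set ι)) ≤ optVal A (h '' R) + δ := by
    rw [optVal_le_iff hA hne (H.finite_image R) (hRne.to_set.image _) (H.cont_image R)]
    refine ⟨w, hw.1, ?_⟩
    rintro _ ⟨j, hj, rfl⟩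
    have := hw.2 _ ⟨j, hj, rfl⟩
    dsimp only
    linarith [(hη j).2]
  linarith

end Violation

/-! ### From the hypergeometric to the binomial tail -/

section Asymptotics

open Filter Topology

theorem tendsto_choose_div_pow {a : ℕ → ℕ} {c : ℝ}
    (ha : Tendsto (fun M : ℕ => (a M : ℝ) / M) atTop (𝓝 c)) (i : ℕ) :
    Tendsto (fun M : ℕ => ((a M).choose i : ℝ) / (M : ℝ) ^ i) atTop
      (𝓝 (c ^ i / (i.factorial : ℝ))) := by
  have hsub : ∀ k : ℕ, Tendsto (fun M : ℕ => ((a M - k : ℕ) : ℝ) / M) atTop (𝓝 c) := by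
    intro k
    have h0 : Tendsto (fun M : ℕ => (a M : ℝ) / M - (k : ℝ) / M) atTop (𝓝 (c - 0)) :=
      ha.sub (tendsto_const_div_atTop_nhds_zero_nat (k : ℝ))
    rw [sub_zero] at h0
    refine tendsto_of_tendsto_of_tendsto_of_le_of_le h0 ha (fun M => ?_) (fun M => ?_)
    · have : (a M : ℝ) - k ≤ ((a M - k : ℕ) : ℝ) := by
        rw [sub_le_iff_le_add]; exact_mod_cast (by omega : a M ≤ a M - k + k)
      simp only [← sub_div]; gcongr
    · gcongr; omega
  have hdesc : ∀ i : ℕ, Tendsto (fun M : ℕ => ((a M).descFactorial i : ℝ) / (M : ℝ) ^ i) atTop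
      (𝓝 (c ^ i)) := by
    intro i
    induction i with
    | zero => simp
    | succ i ih =>
      refine ((hsub i).mul ih).congr' (Eventually.of_forall fun M => ?_) |>.trans_eq ?_
      · rw [Nat.descFactorial_succ, Nat.cast_mul, pow_succ', div_mul_div_comm]
      · rw [pow_succ']
  refine ((hdesc i).div_const (i.factorial : ℝ)).congr fun M => ?_
  rw [Nat.descFactorial_eq_factorial_mul_choose, Nat.cast_mul]
  field_simp

/-- Divide each binomial coefficient by the matching power of `M`: numerator and denominator both
have order `M ^ K`, and the factorials in the limit recombine to `K.choose i`. -/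
theorem tendsto_hypergeometric {K d : ℕ} (hd : d ≤ K) {ν : ℝ} (hν : 0 ≤ ν) (hν1 : ν ≤ 1) :
    Tendsto (fun M : ℕ => (((∑ i ∈ Finset.range d, (⌊ν * M⌋₊ + d).choose i *
        (K + M - (⌊ν * M⌋₊ + d)).choose (K - i) : ℕ)) : ℝ) / ((K + M).choose K : ℝ)) atTop
      (𝓝 (∑ i ∈ Finset.range d, (K.choose i : ℝ) * (1 - ν) ^ (K - i) * ν ^ i)) := by
  have hJ : Tendsto (fun M : ℕ => ((⌊ν * M⌋₊ + d : ℕ) : ℝ) / M) atTop (𝓝 ν) := by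
    have := ((tendsto_nat_floor_mul_div_atTop hν).comp (tendsto_natCast_atTop_atTop (R := ℝ))).add
      (tendsto_const_div_atTop_nhds_zero_nat (d : ℝ))
    rw [add_zero] at this
    refine this.congr fun M => ?_
    simp only [Function.comp, Nat.cast_add, add_div]
  have hone : Tendsto (fun M : ℕ => ((K + M : ℕ) : ℝ) / M) atTop (𝓝 1) := by
    have := (tendsto_const_div_atTop_nhds_zero_nat (K : ℝ)).add
      (tendsto_const_nhds (x := (1 : ℝ)))
    rw [zero_add] at this
    refine this.congr' ?_
    filter_upwards [eventually_gt_atTop 0] with M hM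
    have : (M : ℝ) ≠ 0 := by positivity
    push_cast
    field_simp
  have hrest : Tendsto (fun M : ℕ => ((K + M - (⌊ν * M⌋₊ + d) : ℕ) : ℝ) / M) atTop
      (𝓝 (1 - ν)) := by
    refine (hone.sub hJ).congr fun M => ?_
    have hle : ⌊ν * M⌋₊ ≤ M := by
      refine Nat.floor_le_of_le ?_
      nlinarith [Nat.cast_nonneg (α := ℝ) M]
    rw [← sub_div, Nat.cast_sub (by omega : ⌊ν * M⌋₊ + d ≤ K + M)]
  have hden := tendsto_choose_div_pow hone K
  have hsum : Tendsto (fun M : ℕ => ∑ i ∈ Finset.range d,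
      (((⌊ν * M⌋₊ + d).choose i : ℝ) / (M : ℝ) ^ i *
        (((K + M - (⌊ν * M⌋₊ + d)).choose (K - i) : ℝ) / (M : ℝ) ^ (K - i))) /
      (((K + M).choose K : ℝ) / (M : ℝ) ^ K)) atTop
      (𝓝 (∑ i ∈ Finset.range d, (ν ^ i / (i.factorial : ℝ) *
        ((1 - ν) ^ (K - i) / ((K - i).factorial : ℝ))) / (1 ^ K / (K.factorial : ℝ)))) := by
    refine tendsto_finsetSum _ fun i _ => ?_
    exact ((tendsto_choose_div_pow hJ i).mul (tendsto_choose_div_pow hrest (K - i))).div hden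
      (by positivity)
  refine (hsum.congr' ?_).trans_eq ?_
  · filter_upwards [eventually_gt_atTop 0] with M hM
    have hM' : (M : ℝ) ≠ 0 := by positivity
    rw [Nat.cast_sum, Finset.sum_div]
    refine Finset.sum_congr rfl fun i hi => ?_
    have hi' : i ≤ K := by have := Finset.mem_range.1 hi; omega
    have hC : ((K + M).choose K : ℝ) ≠ 0 := by
      have := Nat.choose_pos (Nat.le_add_right K M); positivity
    rw [div_mul_div_comm, ← pow_add, Nat.add_sub_cancel' hi', div_div_div_cancel_right₀
      (by positivity), Nat.cast_mul]
  · congr 1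
    refine Finset.sum_congr rfl fun i hi => ?_
    have hi' : i ≤ K := by have := Finset.mem_range.1 hi; omega
    rw [Nat.cast_choose ℝ hi']
    field_simp
    simp

end Asymptotics

/-! ### Fresh samples and measurability -/

section Sampling

open MeasureTheory ProbabilityTheory Filter Topology

/-- The set `s` lies in the liminf of `t`, an increasing union of intersections. Continuity from
below requires no measurability here, which matters because `s` will be a set of bad samples not
known to be measurable. -/
theorem measure_le_of_eventually_mem {α : Type*} [MeasurableSpace α] {μ : Measure α} {s : Set α}
    {t : ℕ → Set α} {a : ENNReal} (hs : ∀ x ∈ s, ∀ᶠ k in atTop, x ∈ t k)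
    (ht : ∃ᶠ k in atTop, μ (t k) ≤ a) : μ s ≤ a := by
  have hsub : s ⊆ ⋃ m : ℕ, ⋂ k ≥ m, t k := by
    intro x hx
    obtain ⟨m, hm⟩ := eventually_atTop.1 (hs x hx)
    exact Set.mem_iUnion.2 ⟨m, by simpa using hm⟩
  refine (measure_mono hsub).trans ?_
  rw [Monotone.measure_iUnion]
  · refine iSup_le fun m => ?_
    obtain ⟨k, hk, hmk⟩ := (ht.and_eventually (eventually_ge_atTop m)).exists
    exact (measure_mono (Set.iInter₂_subset k hmk)).trans hk
  · intro m m' hmm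
    exact Set.biInter_subset_biInter_left fun k (hk : m' ≤ k) => hmm.trans hk

variable {Ω : Type*} [MeasurableSpace Ω] {μ : Measure Ω} [IsProbabilityMeasure μ]

-- Chebyshev's inequality for the number of hits, whose mean is at least `(ν + t) M` and whose
-- variance is at most `M / 4`.
open Classical in
theorem one_sub_le_measure_count {S : Set Ω} (hS : MeasurableSet S) {ν t : ℝ} (hν : 0 ≤ ν)
    (ht : 0 < t) (hSν : ν + t ≤ μ.real S) {M : ℕ} (hM : 0 < M) :
    ENNReal.ofReal (1 - 1 / (4 * M * t ^ 2)) ≤ (Measure.pi fun _ : Fin M => μ)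
      {x : Fin M → Ω | ⌊ν * M⌋₊ < (Finset.univ.filter fun j => x j ∈ S).card} := by
  set P := Measure.pi fun _ : Fin M => μ
  have hMr : (0 : ℝ) < M := by exact_mod_cast hM
  let X : Ω → ℝ := S.indicator fun _ => 1
  have hX : MemLp X 2 μ := memLp_indicator_const 2 hS 1 (Or.inr (measure_ne_top _ _))
  have hXm : Measurable X := measurable_const.indicator hS
  let Y : (Fin M → Ω) → ℝ := ∑ j, fun x => X (x j)
  have hYm : Measurable Y := by
    have : Y = fun x => ∑ j, X (x j) := by ext; simp [Y]
    rw [this]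
    exact Finset.measurable_sum _ fun j _ => hXm.comp (measurable_pi_apply j)
  have hY : MemLp Y 2 P := memLp_finsetSum' _ fun j _ =>
    hX.comp_measurePreserving (measurePreserving_eval (fun _ => μ) j)
  have hYcount : ∀ x, Y x = ((Finset.univ.filter fun j => x j ∈ S).card : ℝ) := by
    intro x
    simp [Y, X, Set.indicator_apply, Finset.sum_boole]
  have hmean : ∫ x, Y x ∂P = M * μ.real S := by
    simp only [Y, Finset.sum_apply]
    rw [integral_finsetSum]
    · simp only [P]
      simp_rw [integral_comp_eval (μ := fun _ : Fin M => μ) hX.aestronglyMeasurable]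
      simp [X, integral_indicator_const _ hS]
    · intro j _
      exact (hX.comp_measurePreserving (measurePreserving_eval (fun _ => μ) j)).integrable
        (by norm_num)
  have hvar : Var[Y; P] ≤ M / 4 := by
    rw [variance_sum_pi fun _ => hX]
    have h1 : Var[X; μ] ≤ 1 / 4 := by
      refine (variance_le_sq_of_bounded (a := 0) (b := 1) (ae_of_all _ fun u => ?_)
        hXm.aemeasurable).trans (by norm_num)
      simp only [X, Set.indicator_apply]
      split_ifs <;> simp
    simp only [Finset.sum_const, Finset.card_univ, Fintype.card_fin, nsmul_eq_mul]
    nlinarith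
  have hcheb := meas_ge_le_variance_div_sq hY (c := M * t) (by positivity)
  have hmeas : MeasurableSet {x : Fin M → Ω | ⌊ν * M⌋₊ < (Finset.univ.filter fun j : Fin M => x j ∈ S).card} := by
    have : {x : Fin M → Ω | ⌊ν * M⌋₊ < (Finset.univ.filter fun j : Fin M => x j ∈ S).card} =
        {x | (⌊ν * M⌋₊ : ℝ) < Y x} := by
      ext x; simp [hYcount]
    rw [this]
    exact measurableSet_lt measurable_const hYm
  have hcompl : P {x : Fin M → Ω | ⌊ν * M⌋₊ < (Finset.univ.filter fun j : Fin M => x j ∈ S).card}ᶜ ≤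
      ENNReal.ofReal (1 / (4 * M * t ^ 2)) := by
    refine (measure_mono fun x hx => ?_).trans (hcheb.trans (ENNReal.ofReal_le_ofReal ?_))
    · simp only [Set.mem_compl_iff, Set.mem_ofPred_eq, not_lt] at hx ⊢
      have h1 : Y x ≤ ν * M := by
        rw [hYcount]
        exact (Nat.cast_le.2 hx).trans (Nat.floor_le (by positivity))
      rw [hmean, abs_sub_comm]
      refine le_trans ?_ (le_abs_self _)
      nlinarith
    · calc Var[Y; P] / (M * t) ^ 2 ≤ (M / 4) / (M * t) ^ 2 := by gcongr
        _ = 1 / (4 * M * t ^ 2) := by field_simp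
  rw [ENNReal.ofReal_sub _ (by positivity), ENNReal.ofReal_one, tsub_le_iff_right]
  calc (1 : ENNReal) = P {x : Fin M → Ω | ⌊ν * M⌋₊ < (Finset.univ.filter fun j : Fin M => x j ∈ S).card} +
        P {x : Fin M → Ω | ⌊ν * M⌋₊ < (Finset.univ.filter fun j : Fin M => x j ∈ S).card}ᶜ :=
        (prob_add_prob_compl hmeas).symm
    _ ≤ _ := by gcongr

variable {E : Type*} [NormedAddCommGroup E] [NormedSpace ℝ E] [FiniteDimensional ℝ E] {A : Set E}
  {h : Ω → E → ℝ}

/-- By continuity, a point with all constraints strictly below `a` can be found in a countable dense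
subset of `A`, so strict sublevel sets of the value are countable unions. -/
theorem measurable_optVal (hA : IsCompact A) (hne : A.Nonempty)
    (hm : ∀ w ∈ A, Measurable fun u => h u w) (hc : ∀ u, ContinuousOn (h u) A)
    {X α : Type*} [MeasurableSpace X] [Finite α] [Nonempty α] {y : α → X → Ω}
    (hy : ∀ i, Measurable (y i)) :
    Measurable fun x => optVal A (Set.range fun i => h (y i x)) := by
  have : ProperSpace E := FiniteDimensional.proper ℝ E
  obtain ⟨D, hDc, hD⟩ := TopologicalSpace.exists_countable_dense A
  refine measurable_of_Iio fun a => ?_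
  have heq : (fun x => optVal A (Set.range fun i => h (y i x))) ⁻¹' Set.Iio a =
      ⋃ w ∈ D, ⋂ i, {x | h (y i x) w < a} := by
    ext x
    simp only [Set.mem_preimage, Set.mem_Iio, Set.mem_iUnion, Set.mem_iInter, Set.mem_ofPred_eq]
    rw [optVal_lt_iff hA hne (Set.finite_range _) (Set.range_nonempty _)
      (by rintro _ ⟨i, rfl⟩; exact hc _)]
    simp only [Set.forall_mem_range, exists_prop]
    constructor
    · rintro ⟨w, hw, hlt⟩
      have hopen : IsOpen {v : A | ∀ i, h (y i x) v < a} := by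
        rw [Set.ofPred_forall]
        exact isOpen_iInter_of_finite fun i =>
          isOpen_lt (continuousOn_iff_continuous_domRestrict.1 (hc (y i x))) continuous_const
      obtain ⟨v, hv, hvD⟩ := hD.exists_mem_open hopen ⟨⟨w, hw⟩, hlt⟩
      exact ⟨v, hv, hvD⟩
    · rintro ⟨w, -, hlt⟩
      exact ⟨w, w.2, hlt⟩
  rw [heq]
  exact MeasurableSet.biUnion hDc fun w _ => MeasurableSet.iInter fun i =>
    measurableSet_lt ((hm w w.2).comp (hy i)) measurable_const

end Sampling

/-! ### Exchangeability and the strictly convex scenario bound -/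

section Scenario

open MeasureTheory ProbabilityTheory Filter Topology

/-- The outcomes whose constraint raises the optimal value of the program given by `ω`. -/
def violationSet {Ω E α : Type*} (A : Set E) (h : Ω → E → ℝ) (ω : α → Ω) : Set Ω :=
  {u | optVal A (Set.range fun i => h (ω i)) < optVal A (insert (h u) (Set.range fun i => h (ω i)))}

theorem card_violators_comp {E ι : Type*} [Fintype ι] {A : Set E} (σ : Equiv.Perm ι) (g : ι → E → ℝ)
    (R : Finset ι) :
    (violators A (fun i => g (σ i)) R).card = (violators A g (R.map σ.toEmbedding)).card := by
  classical
  rw [← Finset.card_map σ.toEmbedding]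
  congr 1
  ext i
  simp only [violators, Finset.mem_map, Finset.mem_filter, Finset.mem_univ, true_and,
    Finset.coe_map, Equiv.coe_toEmbedding, Set.image_image]
  constructor
  · rintro ⟨j, hj, rfl⟩; exact hj
  · intro hi; exact ⟨σ.symm i, by simpa using hi, by simp⟩

theorem Finset.exists_perm_map_eq {ι : Type*} [Finite ι] {R S : Finset ι}
    (hRS : R.card = S.card) : ∃ σ : Equiv.Perm ι, R.map σ.toEmbedding = S := by
  classical
  refine ⟨(Finset.equivOfCardEq hRS).extendSubtype,
    Finset.eq_of_subset_of_card_le (fun i hi => ?_) (by simp [hRS])⟩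
  obtain ⟨j, hj, rfl⟩ := Finset.mem_map.1 hi
  exact Equiv.extendSubtype_mem _ j hj

variable {Ω : Type*} [MeasurableSpace Ω] {μ : Measure Ω} [IsProbabilityMeasure μ]
  {E : Type*} [NormedAddCommGroup E] [NormedSpace ℝ E] [FiniteDimensional ℝ E] {A : Set E}
  {h : Ω → E → ℝ}

theorem measurableSet_raises (hA : IsCompact A) (hne : A.Nonempty)
    (hm : ∀ w ∈ A, Measurable fun u => h u w) (hc : ∀ u, ContinuousOn (h u) A)
    {X α : Type*} [MeasurableSpace X] [Finite α] [Nonempty α] {y : α → X → Ω}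
    (hy : ∀ i, Measurable (y i)) {z : X → Ω} (hz : Measurable z) :
    MeasurableSet {x | z x ∈ violationSet A h fun i => y i x} := by
  refine measurableSet_lt (measurable_optVal hA hne hm hc hy) ?_
  have := measurable_optVal hA hne hm hc (X := X) (α := Option α)
    (y := fun o x => o.elim (z x) fun i => y i x) (by rintro (_ | i) <;> simp [hz, hy])
  have heq : ∀ x, insert (h (z x)) (Set.range fun i => h (y i x)) =
      Set.range fun o : Option α => h (o.elim (z x) fun i => y i x) := by
    intro x
    ext f
    simp [Option.exists, eq_comm]
  simp only [heq]
  exact this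

/-- Permuting coordinates preserves the product measure, so the event has the same probability for
every index set of size `R₀.card`. The sum of these probabilities is the expectation of a count
bounded pointwise by `card_filter_violators_le`. -/
theorem choose_mul_measure_le (hA : IsCompact A) (hne : A.Nonempty)
    (hm : ∀ w ∈ A, Measurable fun u => h u w) (hc : ∀ u, ContinuousOn (h u) A)
    (hs : ∀ u, StrictConvexOn ℝ A (h u)) {ι : Type*} [Fintype ι] {d J : ℕ}
    (hd : Module.finrank ℝ E + 1 ≤ d) (R₀ : Finset ι) (hN : d ≤ R₀.card)
    (hJ : J + d ≤ Fintype.card ι) :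
    ((Fintype.card ι).choose R₀.card : ENNReal) * (Measure.pi fun _ : ι => μ)
      {x | J < (violators A (fun i => h (x i)) R₀).card} ≤
      ((∑ i ∈ Finset.range d, (J + d).choose i *
        (Fintype.card ι - (J + d)).choose (R₀.card - i) : ℕ) : ENNReal) := by
  classical
  set P := Measure.pi fun _ : ι => μ
  let X : Finset ι → Set (ι → Ω) := fun R => {x | J < (violators A (fun i => h (x i)) R).card}
  have hXm : ∀ R : Finset ι, R.card = R₀.card → MeasurableSet (X R) := by
    intro R hR
    have hRne : Nonempty R := (Finset.card_pos.1 (by omega)).to_subtype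
    have hcard : Measurable fun x : ι → Ω => (violators A (fun i => h (x i)) R).card := by
      simp only [violators, Finset.card_filter]
      refine Finset.measurable_sum _ fun i _ => Measurable.ite ?_ measurable_const measurable_const
      have := measurableSet_raises hA hne hm hc (X := ι → Ω) (α := R)
        (y := fun j x => x j) (fun j => measurable_pi_apply _) (z := fun x => x i)
        (measurable_pi_apply i)
      refine (Eq.subst ?_ this)
      ext x
      simp only [violationSet, Set.mem_ofPred_eq, Set.image_eq_range]
      rfl
    exact measurableSet_lt measurable_const hcard
  have hsym : ∀ R : Finset ι, R.card = R₀.card → P (X R) = P (X R₀) := by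
    intro R hR
    obtain ⟨σ, hσ⟩ := Finset.exists_perm_map_eq hR
    have hmp := measurePreserving_piCongrLeft (fun _ : ι => μ) σ
    rw [← hmp.measure_preimage_equiv (X R₀)]
    congr 1
    ext x
    have hx : ∀ i, MeasurableEquiv.piCongrLeft (fun _ : ι => Ω) σ x (σ i) = x i := fun i =>
      Equiv.piCongrLeft_apply_apply (fun _ : ι => Ω) σ x i
    simp only [X, Set.mem_preimage, Set.mem_ofPred_eq, ← hσ, ← card_violators_comp, hx]
  have hsum : ∑ R ∈ Finset.powersetCard R₀.card (Finset.univ : Finset ι), P (X R) ≤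
      ((∑ i ∈ Finset.range d, (J + d).choose i *
        (Fintype.card ι - (J + d)).choose (R₀.card - i) : ℕ) : ENNReal) := by
    calc ∑ R ∈ Finset.powersetCard R₀.card (Finset.univ : Finset ι), P (X R)
        = ∑ R ∈ Finset.powersetCard R₀.card (Finset.univ : Finset ι),
            ∫⁻ x, (X R).indicator 1 x ∂P := by
          refine Finset.sum_congr rfl fun R hR => ?_
          rw [lintegral_indicator_one (hXm R (Finset.mem_powersetCard.1 hR).2)]
      _ = ∫⁻ x, ∑ R ∈ Finset.powersetCard R₀.card (Finset.univ : Finset ι),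
            (X R).indicator 1 x ∂P := by
          rw [lintegral_finsetSum]
          exact fun R hR => measurable_one.indicator (hXm R (Finset.mem_powersetCard.1 hR).2)
      _ ≤ ∫⁻ x, ((∑ i ∈ Finset.range d, (J + d).choose i *
            (Fintype.card ι - (J + d)).choose (R₀.card - i) : ℕ) : ENNReal) ∂P := by
          refine lintegral_mono fun x => ?_
          have := card_filter_violators_le (h := fun i => h (x i)) hA hne (fun i => hc (x i))
            (fun i => hs (x i)) hd hN hJ
          rw [Finset.card_filter] at this
          refine le_trans (le_of_eq ?_) (Nat.cast_le.2 this)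
          rw [Nat.cast_sum]
          refine Finset.sum_congr rfl fun R _ => ?_
          simp [X, Set.indicator_apply]
      _ = _ := by simp
  refine le_trans (le_of_eq ?_) hsum
  rw [Finset.sum_congr rfl fun R hR => hsym R (Finset.mem_powersetCard.1 hR).2, Finset.sum_const,
    Finset.card_powersetCard, Finset.card_univ, nsmul_eq_mul]

open Classical in
/-- The samples `(ω, ω')` such that more than `J` of the outcomes `ω'` violate the program `ω`. -/
def manyViolations {Ω E : Type*} (A : Set E) (h : Ω → E → ℝ) (K M J : ℕ) :
    Set ((Fin K → Ω) × (Fin M → Ω)) :=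
  {p | J < (Finset.univ.filter fun j => p.2 j ∈ violationSet A h p.1).card}

theorem measurableSet_manyViolations (hA : IsCompact A) (hne : A.Nonempty)
    (hm : ∀ w ∈ A, Measurable fun u => h u w) (hc : ∀ u, ContinuousOn (h u) A) {K : ℕ}
    (hK : 0 < K) (M J : ℕ) : MeasurableSet (manyViolations A h K M J) := by
  have : Nonempty (Fin K) := ⟨⟨0, hK⟩⟩
  simp only [manyViolations, Finset.card_filter]
  refine measurableSet_lt measurable_const ?_
  refine Finset.measurable_sum _ fun j _ => Measurable.ite ?_ measurable_const measurable_const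
  exact measurableSet_raises hA hne hm hc (X := (Fin K → Ω) × (Fin M → Ω)) (α := Fin K)
    (y := fun i p => p.1 i) (fun i => (measurable_pi_apply i).comp measurable_fst)
    (z := fun p => p.2 j) ((measurable_pi_apply j).comp measurable_snd)

theorem measurableSet_mem_violationSet (hA : IsCompact A) (hne : A.Nonempty)
    (hm : ∀ w ∈ A, Measurable fun u => h u w) (hc : ∀ u, ContinuousOn (h u) A) {K : ℕ}
    (hK : 0 < K) : MeasurableSet {p : (Fin K → Ω) × Ω | p.2 ∈ violationSet A h p.1} := by
  have : Nonempty (Fin K) := ⟨⟨0, hK⟩⟩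
  exact measurableSet_raises hA hne hm hc (X := (Fin K → Ω) × Ω) (α := Fin K)
    (y := fun i p => p.1 i) (fun i => (measurable_pi_apply i).comp measurable_fst)
    (z := Prod.snd) measurable_snd

/-- Fubini: for each fixed `ω` with large violation probability, `one_sub_le_measure_count` applies
to the fresh samples. -/
theorem mul_measure_le_manyViolations (hA : IsCompact A) (hne : A.Nonempty)
    (hm : ∀ w ∈ A, Measurable fun u => h u w) (hc : ∀ u, ContinuousOn (h u) A) {K M : ℕ}
    (hK : 0 < K) (hM : 0 < M) {ν t : ℝ} (hν : 0 ≤ ν) (ht : 0 < t) :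
    ENNReal.ofReal (1 - 1 / (4 * M * t ^ 2)) * (Measure.pi fun _ : Fin K => μ)
      {ω | ν + t ≤ μ.real (violationSet A h ω)} ≤
      ((Measure.pi fun _ : Fin K => μ).prod (Measure.pi fun _ : Fin M => μ))
        (manyViolations A h K M ⌊ν * M⌋₊) := by
  have hpair := measurableSet_mem_violationSet hA hne hm hc hK
  have hGm : MeasurableSet {ω : Fin K → Ω | ν + t ≤ μ.real (violationSet A h ω)} :=
    measurableSet_le measurable_const (measurable_measure_prodMk_left hpair).ennreal_toReal
  rw [Measure.prod_apply (measurableSet_manyViolations hA hne hm hc hK M _), ← setLIntegral_const]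
  refine (setLIntegral_mono' hGm fun ω hω => ?_).trans (setLIntegral_le_lintegral _ _)
  exact one_sub_le_measure_count (measurable_prodMk_left hpair) hν ht hω hM

theorem measure_manyViolations_le {E : Type*} {A : Set E} {h : Ω → E → ℝ} (K M J : ℕ) :
    ((Measure.pi fun _ : Fin K => μ).prod (Measure.pi fun _ : Fin M => μ))
        (manyViolations A h K M J) ≤ (Measure.pi fun _ : Fin K ⊕ Fin M => μ)
      {x | J < (violators A (fun i => h (x i))
        ((Finset.univ : Finset (Fin K)).map Function.Embedding.inl)).card} := by
  rw [← (measurePreserving_sumPiEquivProdPi fun _ : Fin K ⊕ Fin M => μ).measure_preimage_equiv]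
  refine measure_mono fun x hx => ?_
  rw [Set.mem_preimage, manyViolations, Set.mem_ofPred_eq] at hx
  refine hx.trans_le ?_
  rw [← Finset.card_map Function.Embedding.inr]
  refine Finset.card_le_card fun i hi => ?_
  obtain ⟨j, hj, rfl⟩ := Finset.mem_map.1 hi
  simp only [Finset.mem_filter, Finset.mem_univ, true_and] at hj
  simp only [violators, Finset.mem_filter, Finset.mem_univ, true_and]
  have himage : (fun i => h (x i)) '' ((Finset.univ : Finset (Fin K)).map
      Function.Embedding.inl : Finset (Fin K ⊕ Fin M)) =
      Set.range fun i => h (x (Sum.inl i)) := by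
    simp only [Finset.coe_map, Finset.coe_univ, Set.image_univ, ← Set.range_comp]
    rfl
  rw [himage]
  exact hj

theorem choose_mul_measureReal_le (hA : IsCompact A) (hne : A.Nonempty)
    (hm : ∀ w ∈ A, Measurable fun u => h u w) (hc : ∀ u, ContinuousOn (h u) A)
    (hs : ∀ u, StrictConvexOn ℝ A (h u)) {d K M : ℕ} (hd : Module.finrank ℝ E + 1 ≤ d)
    (hK : d ≤ K) {ν t : ℝ} (hν : 0 ≤ ν) (hν1 : ν ≤ 1) (ht : 0 < t) (hM : 0 < M) :
    ((K + M).choose K : ℝ) * ((1 - 1 / (4 * M * t ^ 2)) * (Measure.pi fun _ : Fin K => μ).real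
      {ω | ν + t ≤ μ.real (violationSet A h ω)}) ≤
      ((∑ i ∈ Finset.range d, (⌊ν * M⌋₊ + d).choose i *
        (K + M - (⌊ν * M⌋₊ + d)).choose (K - i) : ℕ) : ℝ) := by
  have hJM : ⌊ν * M⌋₊ ≤ M := by
    refine Nat.floor_le_of_le ?_
    nlinarith [Nat.cast_nonneg (α := ℝ) M]
  have key := choose_mul_measure_le (μ := μ) hA hne hm hc hs (ι := Fin K ⊕ Fin M) (d := d)
    (J := ⌊ν * M⌋₊) hd ((Finset.univ : Finset (Fin K)).map Function.Embedding.inl)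
    (by simpa using hK) (by rw [Fintype.card_sum, Fintype.card_fin, Fintype.card_fin]; omega)
  rw [Finset.card_map, Finset.card_univ, Fintype.card_sum, Fintype.card_fin,
    Fintype.card_fin] at key
  have hYX := (mul_measure_le_manyViolations (μ := μ) hA hne hm hc (K := K) (by omega) hM hν
    ht).trans (measure_manyViolations_le K M _)
  have hfin := (mul_le_mul_right hYX ((K + M).choose K : ENNReal)).trans key
  have hreal := ENNReal.toReal_mono (ENNReal.natCast_ne_top _) hfin
  rw [ENNReal.toReal_mul, ENNReal.toReal_mul, ENNReal.toReal_natCast,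
    ENNReal.toReal_natCast] at hreal
  refine le_trans ?_ hreal
  refine mul_le_mul_of_nonneg_left ?_ (Nat.cast_nonneg _)
  refine mul_le_mul_of_nonneg_right ?_ measureReal_nonneg
  rw [ENNReal.toReal_ofReal']
  exact le_max_left _ _

/-- The scenario bound for min-max programs with strictly convex constraints on a compact set. -/
theorem measure_violationSet_le (hA : IsCompact A) (hne : A.Nonempty)
    (hm : ∀ w ∈ A, Measurable fun u => h u w) (hc : ∀ u, ContinuousOn (h u) A)
    (hs : ∀ u, StrictConvexOn ℝ A (h u)) {d K : ℕ} (hd : Module.finrank ℝ E + 1 ≤ d)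
    (hK : d ≤ K) {ν : ℝ} (hν : 0 ≤ ν) (hν1 : ν ≤ 1) :
    (Measure.pi fun _ : Fin K => μ) {ω | ν < μ.real (violationSet A h ω)} ≤
      ENNReal.ofReal (∑ i ∈ Finset.range d, (K.choose i : ℝ) * (1 - ν) ^ (K - i) * ν ^ i) := by
  -- A margin `t > 0` is needed for Chebyshev's inequality; a strict excess over `ν` eventually
  -- exceeds the margin `1 / (k + 1)`.
  refine measure_le_of_eventually_mem
    (t := fun k : ℕ => {ω | ν + 1 / ((k : ℝ) + 1) ≤ μ.real (violationSet A h ω)})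
    (fun ω hω => ?_) (Frequently.of_forall fun k => ?_)
  · have h0 := (tendsto_one_div_add_atTop_nhds_zero_nat (𝕜 := ℝ)).const_add ν
    rw [add_zero] at h0
    filter_upwards [h0.eventually_lt_const hω] with k hk using hk.le
  · have ht : 0 < 1 / ((k : ℝ) + 1) := by positivity
    set t := 1 / ((k : ℝ) + 1)
    rw [← ofReal_measureReal]
    refine ENNReal.ofReal_le_ofReal ?_
    have h1 : Tendsto (fun M : ℕ => (1 - 1 / (4 * (M : ℝ) * t ^ 2)) *
        (Measure.pi fun _ : Fin K => μ).real {ω | ν + t ≤ μ.real (violationSet A h ω)}) atTop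
        (𝓝 ((1 - 0) *
          (Measure.pi fun _ : Fin K => μ).real {ω | ν + t ≤ μ.real (violationSet A h ω)})) := by
      refine (tendsto_const_nhds.sub ?_).mul_const _
      refine (tendsto_const_div_atTop_nhds_zero_nat (1 / (4 * t ^ 2))).congr fun M => ?_
      field_simp
    rw [sub_zero, one_mul] at h1
    refine le_of_tendsto_of_tendsto h1 (tendsto_hypergeometric hK hν hν1) ?_
    filter_upwards [eventually_gt_atTop 0] with M hM
    have hC : (0 : ℝ) < ((K + M).choose K : ℝ) := by
      exact_mod_cast Nat.choose_pos (Nat.le_add_right K M)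
    rw [le_div_iff₀ hC, mul_comm]
    exact choose_mul_measureReal_le hA hne hm hc hs hd hK hν hν1 ht hM

end Scenario

/-! ### From convex to strictly convex programs -/

section Regularization

open MeasureTheory Filter Topology

/-- `w` minimizes `max_i f i w` over `A` with optimal value `τ`, and minimizes `g` among all such
minimizers. -/
structure IsTieBrokenMinMax {E ι : Type*} (A : Set E) (f : ι → E → ℝ) (g : E → ℝ) (τ : ℝ)
    (w : E) : Prop where
  mem : w ∈ A
  le : ∀ i, f i w ≤ τ
  optimal : ∀ w' ∈ A, ∀ τ', (∀ i, f i w' ≤ τ') → τ ≤ τ'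
  tie : ∀ w' ∈ A, (∀ i, f i w' ≤ τ) → g w ≤ g w'

theorem StrictConvexOn.const_mul {E : Type*} [AddCommGroup E] [Module ℝ E] {s : Set E} {g : E → ℝ}
    (hg : StrictConvexOn ℝ s g) {c : ℝ} (hc : 0 < c) : StrictConvexOn ℝ s fun w => c * g w := by
  refine ⟨hg.1, fun x hx y hy hne a b ha hb hab => ?_⟩
  have := mul_lt_mul_of_pos_left (hg.2 hx hy hne ha hb hab) hc
  simp only [smul_eq_mul] at this ⊢
  linarith

variable {E : Type*} [NormedAddCommGroup E] [NormedSpace ℝ E] {A : Set E}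

theorem IsTieBrokenMinMax.eq_of_le {ι : Type*} {f : ι → E → ℝ} {g : E → ℝ} {τ : ℝ} {w v : E}
    (hw : IsTieBrokenMinMax A f g τ w) (hA : Convex ℝ A) (hf : ∀ i, ConvexOn ℝ Set.univ (f i))
    (hg : StrictConvexOn ℝ Set.univ g) (hv : v ∈ A) (hfv : ∀ i, f i v ≤ τ) (hgv : g v ≤ g w) :
    v = w := by
  by_contra hne
  have h1 := hg.2 (Set.mem_univ v) (Set.mem_univ w) hne (show (0 : ℝ) < 1 / 2 by norm_num)
    (show (0 : ℝ) < 1 / 2 by norm_num) (by norm_num)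
  have h2 := hw.tie ((1 / 2 : ℝ) • v + (1 / 2 : ℝ) • w)
    (hA hv hw.mem (by norm_num) (by norm_num) (by norm_num)) fun i => by
      have h3 := (hf i).2 (Set.mem_univ v) (Set.mem_univ w) (show (0 : ℝ) ≤ 1 / 2 by norm_num)
        (show (0 : ℝ) ≤ 1 / 2 by norm_num) (by norm_num)
      have h4 := hfv i
      have h5 := hw.le i
      simp only [smul_eq_mul] at h3
      linarith
  simp only [smul_eq_mul] at h1
  linarith

/-- Comparing `v k` with `w` bounds its constraints by `τ + ε k * (g w - g (v k))`; optimality of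
`τ` then gives `g (v k) ≤ g w`. Every cluster point inherits both bounds in the limit and so equals
`w`. -/
theorem IsTieBrokenMinMax.tendsto {ι : Type*} [Finite ι] [Nonempty ι] {f : ι → E → ℝ} {g : E → ℝ}
    {τ : ℝ} {w : E} (hw : IsTieBrokenMinMax A f g τ w) (hA : IsCompact A) (hA' : Convex ℝ A)
    (hf : ∀ i, ConvexOn ℝ Set.univ (f i)) (hfc : ∀ i, Continuous (f i))
    (hg : StrictConvexOn ℝ Set.univ g) (hgc : Continuous g) {ε : ℕ → ℝ} (hε : ∀ k, 0 < ε k)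
    (hε0 : Tendsto ε atTop (𝓝 0)) {v : ℕ → E}
    (hv : ∀ k, IsMinMax A (Set.range fun i => fun w => f i w + ε k * g w) (v k)) :
    Tendsto v atTop (𝓝 w) := by
  have hval : ∀ k, ∀ i, f i (v k) ≤ τ + ε k * (g w - g (v k)) := by
    intro k i
    have h1 := (hv k).2 _ ⟨i, rfl⟩
    have h2 : optVal A (Set.range fun i => fun w => f i w + ε k * g w) ≤ τ + ε k * g w := by
      rw [optVal_le_iff hA ⟨w, hw.mem⟩ (Set.finite_range _) (Set.range_nonempty _)]
      · refine ⟨w, hw.mem, ?_⟩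
        rintro _ ⟨i, rfl⟩
        have := hw.le i
        dsimp only
        linarith
      · rintro _ ⟨i, rfl⟩
        exact ((hfc i).add (continuous_const.mul hgc)).continuousOn
    dsimp only at h1
    linarith
  have hgle : ∀ k, g (v k) ≤ g w := by
    intro k
    have := hw.optimal (v k) (hv k).1 _ (hval k)
    have h2 : 0 ≤ ε k * (g w - g (v k)) := by linarith
    have h3 := (mul_nonneg_iff_of_pos_left (hε k)).1 h2
    linarith
  refine hA.tendsto_nhds_of_unique_mapClusterPt (Eventually.of_forall fun k => (hv k).1) ?_
  intro x hx hcl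
  obtain ⟨ψ, hψ, hlim⟩ := hcl.tendsto_subseq
  refine hw.eq_of_le hA' hf hg hx (fun i => ?_) ?_
  · have h1 : Tendsto (fun n => f i (v (ψ n))) atTop (𝓝 (f i x)) :=
      ((hfc i).tendsto x).comp hlim
    have h2 : Tendsto (fun n => τ + ε (ψ n) * (g w - g (v (ψ n)))) atTop
        (𝓝 (τ + 0 * (g w - g x))) :=
      tendsto_const_nhds.add ((hε0.comp hψ.tendsto_atTop).mul
        (tendsto_const_nhds.sub ((hgc.tendsto x).comp hlim)))
    rw [zero_mul, add_zero] at h2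
    exact le_of_tendsto_of_tendsto' h1 h2 fun n => hval _ i
  · exact le_of_tendsto' ((hgc.tendsto x).comp hlim) fun n => hgle _

variable {Ω : Type*} [MeasurableSpace Ω] {μ : Measure Ω} [IsProbabilityMeasure μ]

/-- Because `τ < f u w` is strict and the minimizers converge, each such `u` eventually violates the
regularized program. If the regularized violation probability were at most `ν` infinitely often, the
liminf lemma would bound the limiting one by `ν`. -/
theorem IsTieBrokenMinMax.eventually_lt_measure_violationSet {ι : Type*} [Finite ι] [Nonempty ι]
    {f : Ω → E → ℝ} {g : E → ℝ} {τ : ℝ} {w : E} {ω : ι → Ω}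
    (hw : IsTieBrokenMinMax A (fun i => f (ω i)) g τ w) (hA : IsCompact A) (hA' : Convex ℝ A)
    (hf : ∀ u, ConvexOn ℝ Set.univ (f u)) (hfc : ∀ u, Continuous (f u))
    (hg : StrictConvexOn ℝ Set.univ g) (hgc : Continuous g) {ε : ℕ → ℝ} (hε : ∀ k, 0 < ε k)
    (hε0 : Tendsto ε atTop (𝓝 0)) {ν : ℝ} (hν : 0 ≤ ν) (hlt : ν < μ.real {u | τ < f u w}) :
    ∀ᶠ k in atTop, ν < μ.real (violationSet A (fun u w => f u w + ε k * g w) ω) := by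
  have hc : ∀ k u, ContinuousOn (fun w => f u w + ε k * g w) A := fun k u =>
    ((hfc u).add (continuous_const.mul hgc)).continuousOn
  have hs : ∀ k u, StrictConvexOn ℝ A fun w => f u w + ε k * g w := fun k u =>
    ((hf u).add_strictConvexOn (hg.const_mul (hε k))).subset (Set.subset_univ A) hA'
  have hcr : ∀ k, ∀ f' ∈ Set.range fun i => fun w => f (ω i) w + ε k * g w,
      ContinuousOn f' A := by
    rintro k _ ⟨i, rfl⟩; exact hc k _
  have hsr : ∀ k, ∀ f' ∈ Set.range fun i => fun w => f (ω i) w + ε k * g w,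
      StrictConvexOn ℝ A f' := by
    rintro k _ ⟨i, rfl⟩; exact hs k _
  choose v hv using fun k => exists_isMinMax hA ⟨w, hw.mem⟩
    (Set.finite_range fun i => fun w => f (ω i) w + ε k * g w) (Set.range_nonempty _) (hcr k)
  have hlim := hw.tendsto hA hA' (fun i => hf _) (fun i => hfc _) hg hgc hε hε0 hv
  by_contra hcon
  refine absurd hlt (not_lt.2 ?_)
  have hmeas : μ {u | τ < f u w} ≤ ENNReal.ofReal ν := by
    refine measure_le_of_eventually_mem
      (t := fun k => violationSet A (fun u w => f u w + ε k * g w) ω) (fun u hu => ?_) ?_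
    · have h1 : Tendsto (fun k => f u (v k) + ε k * g (v k)) atTop (𝓝 (f u w + 0 * g w)) :=
        (((hfc u).tendsto w).comp hlim).add (hε0.mul ((hgc.tendsto w).comp hlim))
      have h2 : Tendsto (fun k => τ + ε k * g w) atTop (𝓝 (τ + 0 * g w)) :=
        tendsto_const_nhds.add (hε0.mul_const _)
      have h3 : τ + 0 * g w < f u w + 0 * g w := by simpa using hu
      filter_upwards [h2.eventually_lt h1 h3] with k hk
      rw [violationSet, Set.mem_ofPred_eq, (hv k).optVal_lt_insert_iff hA (Set.finite_range _)
        (Set.range_nonempty _) (hcr k) (hsr k) (hc k u)]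
      refine lt_of_le_of_lt ?_ hk
      rw [optVal_le_iff hA ⟨w, hw.mem⟩ (Set.finite_range _) (Set.range_nonempty _) (hcr k)]
      refine ⟨w, hw.mem, ?_⟩
      rintro _ ⟨i, rfl⟩
      have := hw.le i
      dsimp only at this ⊢
      linarith
    · rw [not_eventually] at hcon
      refine hcon.mono fun k hk => ?_
      rw [not_lt] at hk
      rw [← ofReal_measureReal]
      exact ENNReal.ofReal_le_ofReal hk
  rw [measureReal_def]
  exact ENNReal.toReal_le_of_le_ofReal hν hmeas

/-- The scenario bound for convex min-max programs with a strictly convex tie-break rule. -/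
theorem measure_tieBroken_le [FiniteDimensional ℝ E] (hA : IsClosed A) (hA' : Convex ℝ A)
    {f : Ω → E → ℝ} {g : E → ℝ} (hm : ∀ w, Measurable fun u => f u w)
    (hf : ∀ u, ConvexOn ℝ Set.univ (f u)) (hg : StrictConvexOn ℝ Set.univ g) {d K : ℕ}
    (hd : Module.finrank ℝ E + 1 ≤ d) (hK : d ≤ K) {ν : ℝ} (hν : 0 ≤ ν) (hν1 : ν ≤ 1) :
    (Measure.pi fun _ : Fin K => μ) {ω | ∃ τ w, IsTieBrokenMinMax A (fun i => f (ω i)) g τ w ∧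
      ν < μ.real {u | τ < f u w}} ≤
      ENNReal.ofReal (∑ i ∈ Finset.range d, (K.choose i : ℝ) * (1 - ν) ^ (K - i) * ν ^ i) := by
  have hcont : ∀ {f' : E → ℝ}, ConvexOn ℝ Set.univ f' → Continuous f' := fun h =>
    continuousOn_univ.1 (h.continuousOn isOpen_univ)
  have hfc := fun u => hcont (hf u)
  have hgc := hcont hg.convexOn
  have hKne : Nonempty (Fin K) := ⟨⟨0, by omega⟩⟩
  have : ProperSpace E := FiniteDimensional.proper ℝ E
  rcases A.eq_empty_or_nonempty with rfl | ⟨a, ha⟩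
  · rw [Set.eq_empty_of_forall_notMem (s := {ω | _}), measure_empty]
    · exact zero_le
    · rintro ω ⟨τ, w, hw, -⟩
      exact hw.mem
  have hBc : ∀ ρ : ℕ, IsCompact (A ∩ Metric.closedBall a ρ) := fun ρ =>
    (isCompact_closedBall a _).inter_left hA
  have hBv : ∀ ρ : ℕ, Convex ℝ (A ∩ Metric.closedBall a ρ) := fun ρ =>
    hA'.inter (convex_closedBall a _)
  have hε : ∀ k : ℕ, (0 : ℝ) < 1 / ((k : ℝ) + 1) := fun k => by positivity
  -- Two nested liminfs: balls of radius `ρ` eventually contain the solution, and inside each ball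
  -- `ε = 1 / (k + 1)` tends to zero.
  refine measure_le_of_eventually_mem (t := fun ρ : ℕ => {ω | ∀ᶠ k : ℕ in atTop,
    ν < μ.real (violationSet (A ∩ Metric.closedBall a ρ)
      (fun u w => f u w + 1 / ((k : ℝ) + 1) * g w) ω)}) ?_ (Frequently.of_forall fun ρ => ?_)
  · rintro ω ⟨τ, w, hw, hlt⟩
    filter_upwards [eventually_ge_atTop ⌈dist w a⌉₊] with ρ hρ
    have hwρ : w ∈ Metric.closedBall a (ρ : ℝ) := Nat.ceil_le.1 hρ
    have hw' : IsTieBrokenMinMax (A ∩ Metric.closedBall a (ρ : ℝ)) (fun i => f (ω i)) g τ w :=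
      ⟨⟨hw.mem, hwρ⟩, hw.le, fun w' h' => hw.optimal w' h'.1, fun w' h' => hw.tie w' h'.1⟩
    exact hw'.eventually_lt_measure_violationSet (hBc ρ) (hBv ρ) hf hfc hg hgc hε
      tendsto_one_div_add_atTop_nhds_zero_nat hν hlt
  · refine measure_le_of_eventually_mem (fun ω hω => hω) (Frequently.of_forall fun k => ?_)
    refine measure_violationSet_le (hBc ρ) ⟨a, ha, Metric.mem_closedBall_self (by positivity)⟩
      (fun w _ => (hm w).add_const _)
      (fun u => ((hfc u).add (continuous_const.mul hgc)).continuousOn)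
      (fun u => ((hf u).add_strictConvexOn (hg.const_mul (hε k))).subset
        (Set.subset_univ _) (hBv ρ)) hd hK hν hν1

end Regularization

/-! ### First-step analysis of the expected cost -/

section FirstHit

open Filter Topology

theorem pathProb_cons {S : Type*} {P : Matrix S S ℝ} (s : S) {n : ℕ} (π : Fin (n + 1) → S) :
    pathProb P (Fin.cons s π : Fin (n + 2) → S) = P s (π 0) * pathProb P π := by
  simp only [pathProb, Fin.prod_univ_succ (n := n)]
  rfl

theorem pathCost_cons {S : Type*} (c : S → ℝ) (s : S) {n : ℕ} (π : Fin (n + 1) → S) :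
    pathCost c (Fin.cons s π : Fin (n + 2) → S) = c s + pathCost c π := by
  simp only [pathCost, Fin.sum_univ_succ (n := n)]
  rfl

variable {S : Type*} [Fintype S] {P : Matrix S S ℝ} {G : Set S}

theorem mem_firstHitPaths {s : S} {n : ℕ} {π : Fin (n + 1) → S} :
    π ∈ firstHitPaths G s n ↔
      π 0 = s ∧ π (Fin.last n) ∈ G ∧ ∀ i : Fin n, π i.castSucc ∉ G := by
  simp [firstHitPaths]

theorem sum_firstHitPaths_succ {s : S} (hs : s ∉ G) (n : ℕ) (F : (Fin (n + 2) → S) → ℝ) :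
    ∑ π ∈ firstHitPaths G s (n + 1), F π =
      ∑ s', ∑ π ∈ firstHitPaths G s' n, F (Fin.cons s π) := by
  rw [Finset.sum_sigma']
  refine Finset.sum_bij' (fun π _ => ⟨π 1, Fin.tail π⟩) (fun x _ => Fin.cons s x.2) ?_ ?_ ?_ ?_ ?_
  · intro π hπ
    rw [mem_firstHitPaths] at hπ
    simp only [Finset.mem_sigma, Finset.mem_univ, true_and, mem_firstHitPaths]
    exact ⟨rfl, hπ.2.1, fun i => hπ.2.2 i.succ⟩
  · rintro ⟨s', π⟩ hπ
    simp only [Finset.mem_sigma, Finset.mem_univ, true_and, mem_firstHitPaths] at hπ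
    rw [mem_firstHitPaths]
    refine ⟨rfl, hπ.2.1, fun i => ?_⟩
    refine Fin.cases hs (fun j => ?_) i
    exact hπ.2.2 j
  · intro π hπ
    rw [mem_firstHitPaths] at hπ
    simp only [← hπ.1, Fin.cons_self_tail]
  · rintro ⟨s', π⟩ hπ
    simp only [Finset.mem_sigma, Finset.mem_univ, true_and, mem_firstHitPaths] at hπ
    obtain ⟨rfl, -⟩ := hπ
    rfl
  · intro π hπ
    rw [mem_firstHitPaths] at hπ
    simp only [← hπ.1, Fin.cons_self_tail]

theorem firstHitPaths_succ_of_mem {s : S} (hs : s ∈ G) (n : ℕ) :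
    firstHitPaths G s (n + 1) = ∅ := by
  refine Finset.eq_empty_of_forall_notMem fun π hπ => ?_
  rw [mem_firstHitPaths] at hπ
  exact hπ.2.2 0 (by simpa [hπ.1] using hs)

/-- The probability that the chain started in `s` first reaches `G` after exactly `n` steps. -/
noncomputable def firstHitProb (P : Matrix S S ℝ) (G : Set S) (n : ℕ) (s : S) : ℝ :=
  ∑ π ∈ firstHitPaths G s n, pathProb P π

/-- The expected cost on the event that `G` is first reached after exactly `n` steps. -/
noncomputable def firstHitCost (P : Matrix S S ℝ) (c : S → ℝ) (G : Set S) (n : ℕ) (s : S) : ℝ :=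
  ∑ π ∈ firstHitPaths G s n, pathProb P π * pathCost c π

theorem firstHitProb_zero_of_mem {s : S} (hs : s ∈ G) : firstHitProb P G 0 s = 1 := by
  have : firstHitPaths G s 0 = {fun _ => s} := by
    ext π
    rw [mem_firstHitPaths, Finset.mem_singleton]
    constructor
    · rintro ⟨h, -⟩
      funext i
      rw [Fin.fin_one_eq_zero i]
      exact h
    · rintro rfl
      exact ⟨rfl, hs, fun i => i.elim0⟩
  simp [firstHitProb, this, pathProb]

theorem firstHitProb_zero_of_notMem {s : S} (hs : s ∉ G) : firstHitProb P G 0 s = 0 := by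
  refine Finset.sum_eq_zero fun π hπ => ?_
  rw [mem_firstHitPaths] at hπ
  exact absurd (hπ.1 ▸ hπ.2.1) hs

theorem firstHitProb_succ_of_mem {s : S} (hs : s ∈ G) (n : ℕ) :
    firstHitProb P G (n + 1) s = 0 := by
  simp [firstHitProb, firstHitPaths_succ_of_mem hs]

theorem firstHitProb_succ {s : S} (hs : s ∉ G) (n : ℕ) :
    firstHitProb P G (n + 1) s = ∑ s', P s s' * firstHitProb P G n s' := by
  rw [firstHitProb, sum_firstHitPaths_succ hs]
  refine Finset.sum_congr rfl fun s' _ => ?_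
  rw [firstHitProb, Finset.mul_sum]
  refine Finset.sum_congr rfl fun π hπ => ?_
  rw [mem_firstHitPaths] at hπ
  rw [pathProb_cons, hπ.1]

theorem firstHitCost_zero (c : S → ℝ) (s : S) : firstHitCost P c G 0 s = 0 := by
  simp [firstHitCost, pathCost]

theorem firstHitCost_of_mem (c : S → ℝ) {s : S} (hs : s ∈ G) (n : ℕ) :
    firstHitCost P c G n s = 0 := by
  cases n with
  | zero => exact firstHitCost_zero c s
  | succ n => simp [firstHitCost, firstHitPaths_succ_of_mem hs]

theorem firstHitCost_succ (c : S → ℝ) {s : S} (hs : s ∉ G) (n : ℕ) :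
    firstHitCost P c G (n + 1) s =
      ∑ s', P s s' * (c s * firstHitProb P G n s' + firstHitCost P c G n s') := by
  rw [firstHitCost, sum_firstHitPaths_succ hs]
  refine Finset.sum_congr rfl fun s' _ => ?_
  rw [firstHitProb, firstHitCost, Finset.mul_sum, ← Finset.sum_add_distrib, Finset.mul_sum]
  refine Finset.sum_congr rfl fun π hπ => ?_
  rw [mem_firstHitPaths] at hπ
  rw [pathProb_cons, pathCost_cons, hπ.1]
  ring

/-- A stochastic matrix from every state of which `G` is reached with probability one. -/
structure ReachesSurely (P : Matrix S S ℝ) (G : Set S) : Prop where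
  nonneg : ∀ s s', 0 ≤ P s s'
  sum_eq_one : ∀ s, ∑ s', P s s' = 1
  reachProb_eq_one : ∀ s, reachProb P G s = 1

namespace ReachesSurely

theorem firstHitProb_nonneg (H : ReachesSurely P G) (n : ℕ) (s : S) :
    0 ≤ firstHitProb P G n s :=
  Finset.sum_nonneg fun _ _ => Finset.prod_nonneg fun _ _ => H.nonneg _ _

theorem hasSum_firstHitProb (H : ReachesSurely P G) (s : S) :
    HasSum (fun n => firstHitProb P G n s) 1 := by
  have h1 : ∑' n, firstHitProb P G n s = 1 := H.reachProb_eq_one s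
  -- A divergent `tsum` takes the default value zero, so total mass one already implies summability.
  have hs : Summable fun n => firstHitProb P G n s := by
    by_contra hcon
    rw [tsum_eq_zero_of_not_summable hcon] at h1
    exact zero_ne_one h1
  rw [← h1]
  exact hs.hasSum

/-- The probability of not having reached `G` in fewer than `n` steps. -/
noncomputable def survival (P : Matrix S S ℝ) (G : Set S) (n : ℕ) (s : S) : ℝ :=
  1 - ∑ k ∈ Finset.range n, firstHitProb P G k s

theorem survival_zero (s : S) : survival P G 0 s = 1 := by simp [survival]

theorem survival_nonneg (H : ReachesSurely P G) (n : ℕ) (s : S) : 0 ≤ survival P G n s :=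
  sub_nonneg.2 (sum_le_hasSum _ (fun k _ => H.firstHitProb_nonneg k s) (H.hasSum_firstHitProb s))

theorem survival_succ_of_mem {s : S} (hs : s ∈ G) (n : ℕ) : survival P G (n + 1) s = 0 := by
  rw [survival, Finset.sum_range_succ', firstHitProb_zero_of_mem hs]
  simp [firstHitProb_succ_of_mem hs]

theorem survival_succ (H : ReachesSurely P G) {s : S} (hs : s ∉ G) (n : ℕ) :
    survival P G (n + 1) s = ∑ s', P s s' * survival P G n s' := by
  rw [survival, Finset.sum_range_succ', firstHitProb_zero_of_notMem hs]
  simp only [survival, firstHitProb_succ hs, mul_sub, mul_one, Finset.sum_sub_distrib,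
    H.sum_eq_one, add_zero, Finset.mul_sum]
  rw [Finset.sum_comm]

theorem tendsto_survival (H : ReachesSurely P G) (s : S) :
    Tendsto (fun n => survival P G n s) atTop (𝓝 0) := by
  have := (H.hasSum_firstHitProb s).tendsto_sum_nat.const_sub 1
  rwa [sub_self] at this

/-- Iterating the equation `n` times bounds `|x s|` by the survival probability times `∑ |x|`, which
tends to zero. -/
theorem eq_zero_of_harmonic (H : ReachesSurely P G) {x : S → ℝ} (hG : ∀ s ∈ G, x s = 0)
    (hx : ∀ s ∉ G, x s = ∑ s', P s s' * x s') (s : S) : x s = 0 := by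
  have hB : ∀ s, |x s| ≤ ∑ s', |x s'| := fun s =>
    Finset.single_le_sum (f := fun s => |x s|) (fun s _ => abs_nonneg _) (Finset.mem_univ s)
  set B := ∑ s', |x s'|
  have hle : ∀ n, ∀ s, |x s| ≤ survival P G n s * B := by
    intro n
    induction n with
    | zero => intro s; rw [survival_zero, one_mul]; exact hB s
    | succ n ih =>
      intro s
      by_cases hs : s ∈ G
      · rw [survival_succ_of_mem hs, hG s hs]; simp
      · rw [H.survival_succ hs, hx s hs, Finset.sum_mul]
        refine (Finset.abs_sum_le_sum_abs _ _).trans (Finset.sum_le_sum fun s' _ => ?_)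
        rw [abs_mul, abs_of_nonneg (H.nonneg s s'), mul_assoc]
        exact mul_le_mul_of_nonneg_left (ih s') (H.nonneg s s')
  have hlim := (H.tendsto_survival s).mul_const B
  rw [zero_mul] at hlim
  exact abs_nonpos_iff.1 (ge_of_tendsto' hlim fun n => hle n s)

/-- Truncate the series for the expected hitting time where every survival probability is below `1 /
2`. The truncated sum satisfies the first-step equation up to that error, and doubling it absorbs
the error. -/
theorem exists_supersolution (H : ReachesSurely P G) :
    ∃ x : S → ℝ, (∀ s, 0 ≤ x s) ∧ ∀ s ∉ G, 1 + ∑ s', P s s' * x s' ≤ x s := by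
  have hev : ∀ᶠ m in atTop, ∀ s, survival P G m s < 1 / 2 := by
    rw [eventually_all]
    exact fun s => (H.tendsto_survival s).eventually_lt_const (by norm_num)
  obtain ⟨m, hm⟩ := hev.exists
  refine ⟨fun s => 2 * ∑ k ∈ Finset.range m, survival P G k s, fun s =>
    mul_nonneg two_pos.le (Finset.sum_nonneg fun k _ => H.survival_nonneg k s), fun s hs => ?_⟩
  have h1 : ∑ k ∈ Finset.range m, survival P G k s + survival P G m s =
      ∑ s', P s s' * ∑ k ∈ Finset.range m, survival P G k s' + 1 := by
    rw [← Finset.sum_range_succ, Finset.sum_range_succ', survival_zero]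
    simp only [H.survival_succ hs, Finset.mul_sum]
    rw [Finset.sum_comm]
  have h2 : ∑ s', P s s' * (2 * ∑ k ∈ Finset.range m, survival P G k s') =
      2 * ∑ s', P s s' * ∑ k ∈ Finset.range m, survival P G k s' := by
    rw [Finset.mul_sum]
    exact Finset.sum_congr rfl fun s' _ => by ring
  have := hm s
  rw [h2]
  linarith

theorem firstHitCost_one_nonneg (H : ReachesSurely P G) (n : ℕ) (s : S) :
    0 ≤ firstHitCost P (fun _ => 1) G n s :=
  Finset.sum_nonneg fun _ _ => mul_nonneg (Finset.prod_nonneg fun _ _ => H.nonneg _ _)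
    (Finset.sum_nonneg fun _ _ => zero_le_one)

/-- By induction on the cutoff, the partial sums stay below the supersolution. -/
theorem summable_firstHitCost_one (H : ReachesSurely P G) (s : S) :
    Summable fun n => firstHitCost P (fun _ => 1) G n s := by
  obtain ⟨x, hx0, hx⟩ := H.exists_supersolution
  have hle : ∀ N, ∀ s, ∑ n ∈ Finset.range N, firstHitCost P (fun _ => 1) G n s ≤ x s := by
    intro N
    induction N with
    | zero => intro s; simpa using hx0 s
    | succ N ih =>
      intro s
      by_cases hs : s ∈ G
      · simpa [firstHitCost_of_mem _ hs] using hx0 s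
      · rw [Finset.sum_range_succ', firstHitCost_zero, add_zero]
        simp only [firstHitCost_succ _ hs, one_mul]
        rw [Finset.sum_comm]
        refine le_trans ?_ (hx s hs)
        have hone : 1 + ∑ s', P s s' * x s' = ∑ s', P s s' * (1 + x s') := by
          simp only [mul_add, mul_one, Finset.sum_add_distrib, H.sum_eq_one]
        rw [hone]
        refine Finset.sum_le_sum fun s' _ => ?_
        rw [← Finset.mul_sum, Finset.sum_add_distrib]
        refine mul_le_mul_of_nonneg_left (add_le_add ?_ (ih s')) (H.nonneg s s')
        have := H.survival_nonneg N s'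
        rw [survival] at this
        linarith
  exact summable_of_sum_range_le (fun n => H.firstHitCost_one_nonneg n s) (fun N => hle N s)

theorem summable_firstHitCost (H : ReachesSurely P G) (c : S → ℝ) (s : S) :
    Summable fun n => firstHitCost P c G n s := by
  refine Summable.of_norm_bounded ((H.summable_firstHitCost_one s).mul_left (∑ s', |c s'|))
    fun n => ?_
  rw [firstHitCost, firstHitCost, Finset.mul_sum]
  refine (norm_sum_le _ _).trans (Finset.sum_le_sum fun π _ => ?_)
  have hprob : 0 ≤ pathProb P π := Finset.prod_nonneg fun _ _ => H.nonneg _ _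
  have hcost : |pathCost c π| ≤ (∑ s', |c s'|) * pathCost (fun _ => 1) π := by
    rw [pathCost, pathCost, Finset.mul_sum]
    refine (Finset.abs_sum_le_sum_abs _ _).trans (Finset.sum_le_sum fun i _ => ?_)
    rw [mul_one]
    exact Finset.single_le_sum (f := fun s => |c s|) (fun s _ => abs_nonneg _) (Finset.mem_univ _)
  rw [Real.norm_eq_abs, abs_mul, abs_of_nonneg hprob]
  calc pathProb P π * |pathCost c π|
      ≤ pathProb P π * ((∑ s', |c s'|) * pathCost (fun _ => 1) π) := by gcongr
    _ = _ := by ring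

theorem hasSum_firstHitCost (H : ReachesSurely P G) (c : S → ℝ) (s : S) :
    HasSum (fun n => firstHitCost P c G n s) (expectedCost P c G s) :=
  (H.summable_firstHitCost c s).hasSum

theorem expectedCost_of_mem (c : S → ℝ) {s : S} (hs : s ∈ G) : expectedCost P c G s = 0 := by
  have : expectedCost P c G s = ∑' n, firstHitCost P c G n s := rfl
  simp [this, firstHitCost_of_mem c hs]

theorem expectedCost_of_notMem (H : ReachesSurely P G) (c : S → ℝ) {s : S} (hs : s ∉ G) :
    expectedCost P c G s = c s + ∑ s', P s s' * expectedCost P c G s' := by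
  have h1 := (hasSum_nat_add_iff' 1).2 (H.hasSum_firstHitCost c s)
  simp only [Finset.range_one, Finset.sum_singleton, firstHitCost_zero, sub_zero,
    firstHitCost_succ c hs] at h1
  have h2 : HasSum (fun n => ∑ s', P s s' *
      (c s * firstHitProb P G n s' + firstHitCost P c G n s'))
      (∑ s', P s s' * (c s * 1 + expectedCost P c G s')) :=
    hasSum_sum fun s' _ => (((H.hasSum_firstHitProb s').mul_left (c s)).add
      (H.hasSum_firstHitCost c s')).mul_left (P s s')
  rw [h1.unique h2]
  simp only [mul_one, mul_add, Finset.sum_add_distrib, ← Finset.sum_mul, H.sum_eq_one, one_mul]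

theorem eq_expectedCost (H : ReachesSurely P G) {c x : S → ℝ} (hG : ∀ s ∈ G, x s = 0)
    (hx : ∀ s ∉ G, x s = c s + ∑ s', P s s' * x s') (s : S) : x s = expectedCost P c G s := by
  refine sub_eq_zero.1 (H.eq_zero_of_harmonic (x := fun s => x s - expectedCost P c G s)
    (fun s hs => ?_) (fun s hs => ?_) s)
  · rw [hG s hs, expectedCost_of_mem c hs, sub_zero]
  · rw [hx s hs, H.expectedCost_of_notMem c hs]
    simp only [mul_sub, Finset.sum_sub_distrib]
    ring

/-- The combination solves the same linear system, whose solution is unique. -/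
theorem expectedCost_combo (H : ReachesSurely P G) (c c' : S → ℝ) (a b : ℝ) (s : S) :
    expectedCost P (fun s => a * c s + b * c' s) G s =
      a * expectedCost P c G s + b * expectedCost P c' G s := by
  refine (H.eq_expectedCost (x := fun s => a * expectedCost P c G s + b * expectedCost P c' G s)
    (fun s hs => ?_) (fun s hs => ?_) s).symm
  · simp [expectedCost_of_mem _ hs]
  · rw [H.expectedCost_of_notMem c hs, H.expectedCost_of_notMem c' hs]
    simp only [mul_add, Finset.sum_add_distrib, Finset.mul_sum]
    simp only [mul_left_comm]
    ring

theorem convexOn_expectedCost {E : Type*} [AddCommGroup E] [Module ℝ E] (H : ReachesSurely P G)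
    (c : S → (E →ᵃ[ℝ] ℝ)) (s : S) :
    ConvexOn ℝ Set.univ fun w => expectedCost P (fun s => c s w) G s := by
  refine ⟨convex_univ, fun w _ w' _ a b _ _ hab => le_of_eq ?_⟩
  simp only [Convex.combo_affine_apply hab, smul_eq_mul]
  exact H.expectedCost_combo _ _ a b s

end ReachesSurely

end FirstHit

/-! ### The scenario program of an uncertain Markov chain -/

section UMC

open MeasureTheory

variable {S V W : Type*} [Fintype S]

theorem UMC.reachesSurely (D : UMC S V) {G : Set S}
    (hG : ∀ u : D.paramSpace, ∀ s, reachProb (D.inst u) G s = 1) (u : D.paramSpace) :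
    ReachesSurely (D.inst u) G :=
  ⟨fun s s' => ((D.wellDefined u u.2).1 s s').1, (D.wellDefined u u.2).2, hG u⟩

theorem UMC.measurable_inst [Finite V] (D : UMC S V) (s s' : S) :
    Measurable fun u : D.paramSpace => D.inst u s s' := by
  have hcont : Continuous fun u : V → ℝ => D.inst u s s' := by
    simp only [PMC.inst, Matrix.of_apply, MvPolynomial.aeval_def, MvPolynomial.eval₂_eq_eval_map]
    exact MvPolynomial.continuous_eval _
  exact hcont.measurable.comp measurable_subtype_coe

theorem UMC.measurable_expectedCost [Finite V] (D : UMC S V) {G : Set S}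
    (hG : ∀ u : D.paramSpace, ∀ s, reachProb (D.inst u) G s = 1) (c : S → ℝ) (s : S) :
    Measurable fun u : D.paramSpace => expectedCost (D.inst u) c G s := by
  refine measurable_of_tendsto_metrizable
    (f := fun N (u : D.paramSpace) => ∑ n ∈ Finset.range N, firstHitCost (D.inst u) c G n s)
    (fun N => ?_) ?_
  · refine Finset.measurable_sum _ fun n _ => Finset.measurable_sum _ fun π _ => ?_
    refine Measurable.mul_const ?_ _
    exact Finset.measurable_prod _ fun i _ => D.measurable_inst _ _
  · rw [tendsto_pi_nhds]
    exact fun u => ((D.reachesSurely hG u).hasSum_firstHitCost c s).tendsto_sum_nat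

/-- The cost variables are forced to be the expected costs, so they can be eliminated, leaving a
min-max program in `w`. -/
theorem UMC.ScenarioOptimal.isTieBrokenMinMax (D : UMC S V) {G : Set S} {κ : ℝ}
    (hG : ∀ u : D.paramSpace, ∀ s, reachProb (D.inst u) G s = 1)
    {c : S → ((W → ℝ) →ᵃ[ℝ] ℝ)} {A : Set (W → ℝ)} {g : (W → ℝ) → ℝ} {K : ℕ}
    {ω : Fin K → D.paramSpace} {τ : ℝ} {w : W → ℝ} {x : Fin K → S → ℝ}
    (hopt : D.ScenarioOptimal c G κ A ω τ w x)
    (htie : ∀ τ' w' x', D.ScenarioOptimal c G κ A ω τ' w' x' → g w ≤ g w') :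
    τ ≤ κ ∧ IsTieBrokenMinMax A
      (fun i w => expectedCost (D.inst (ω i)) (fun s => c s w) G D.init) g τ w := by
  obtain ⟨hfeas, hmin⟩ := hopt
  -- The same `w` and `x` are feasible with bound `κ`, so the threshold constraint holds
  -- automatically wherever the costs are at most `τ`.
  have hτκ : τ ≤ κ := hmin κ w x
    ⟨hfeas.admissible, hfeas.le_threshold, hfeas.le_threshold, hfeas.target, hfeas.step⟩
  have hfeas' : ∀ w' ∈ A, ∀ τ' ≤ κ,
      (∀ i, expectedCost (D.inst (ω i)) (fun s => c s w') G D.init ≤ τ') →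
      D.ScenarioFeasible c G κ A ω τ' w'
        fun i s => expectedCost (D.inst (ω i)) (fun s => c s w') G s := fun w' hw' τ' hτ' h =>
    ⟨hw', h, fun i => (h i).trans hτ', fun i s hs => ReachesSurely.expectedCost_of_mem _ hs,
      fun i s hs => (D.reachesSurely hG (ω i)).expectedCost_of_notMem _ hs⟩
  refine ⟨hτκ, hfeas.admissible, fun i => ?_, fun w' hw' τ' h => ?_, fun w' hw' h => ?_⟩
  · rw [← (D.reachesSurely hG (ω i)).eq_expectedCost (hfeas.target i) (hfeas.step i)]
    exact hfeas.le_bound i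
  · rcases le_total τ' κ with hle | hle
    · exact hmin _ _ _ (hfeas' w' hw' τ' hle h)
    · exact hτκ.trans hle
  · exact htie τ w' _ ⟨hfeas' w' hw' τ hτκ h, hmin⟩

theorem UMC.satProb_eq [Finite V] (D : UMC S V) {G : Set S}
    (hG : ∀ u : D.paramSpace, ∀ s, reachProb (D.inst u) G s = 1)
    (c : S → ((W → ℝ) →ᵃ[ℝ] ℝ)) (κ : ℝ) (w : W → ℝ) :
    D.satProb c G κ w =
      1 - D.dist.real {u | κ < expectedCost (D.inst u) (fun s => c s w) G D.init} := by
  have := D.isProbabilityMeasure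
  have hmeas : MeasurableSet
      {u : D.paramSpace | κ < expectedCost (D.inst u) (fun s => c s w) G D.init} :=
    measurableSet_lt measurable_const (D.measurable_expectedCost hG _ _)
  have heq : {u | D.Sat c G κ w u} =
      {u : D.paramSpace | κ < expectedCost (D.inst u) (fun s => c s w) G D.init}ᶜ := by
    ext u
    simp [UMC.Sat, hG]
  rw [UMC.satProb, heq, integral_indicator_const _ hmeas.compl, smul_eq_mul, mul_one,
    measureReal_compl hmeas, probReal_univ]

end UMC

theorem theorem3 {S V W : Type*} [Fintype S] [Fintype V] [Fintype W]
    (D : UMC S V) (G : Set S) (κ : ℝ)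
    (hG : ∀ u : D.paramSpace, ∀ s, reachProb (D.inst u) G s = 1)
    (c : S → ((W → ℝ) →ᵃ[ℝ] ℝ))
    (A : Set (W → ℝ)) (hA : IsClosed A) (hA' : Convex ℝ A)
    (g : (W → ℝ) → ℝ) (hg : StrictConvexOn ℝ Set.univ g)
    (K : ℕ) (hK : Fintype.card W + 1 ≤ K) (ν : ℝ) (hν : ν ∈ Set.Ico (0 : ℝ) 1) :
    ∃ E : Set (Fin K → D.paramSpace), MeasurableSet E ∧
      1 - confidence K (Fintype.card W) ν ≤ (Measure.pi fun _ : Fin K => D.dist).real E ∧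
      ∀ ω ∈ E, ∀ w : W → ℝ, D.ScenarioSolution c G κ A g ω w →
        (∀ i, D.Sat c G κ w (ω i)) → 1 - ν ≤ D.satProb c G κ w := by
  have := D.isProbabilityMeasure
  -- For `K = W + 1` the sum defining `confidence` is a full binomial expansion, equal to one, and
  -- the empty event suffices.
  rcases hK.eq_or_lt with rfl | hK
  · refine ⟨∅, MeasurableSet.empty, ?_, fun ω hω => hω.elim⟩
    have h1 : confidence (Fintype.card W + 1) (Fintype.card W) ν = 1 := by
      have := add_pow ν (1 - ν) (Fintype.card W + 1)
      rw [add_sub_cancel, one_pow] at this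
      rw [this, confidence]
      exact Finset.sum_congr rfl fun i _ => by ring
    simp [h1]
  set μK := Measure.pi fun _ : Fin K => D.dist
  set bad : Set (Fin K → D.paramSpace) := {ω | ∃ τ w, IsTieBrokenMinMax A
    (fun i w => expectedCost (D.inst (ω i)) (fun s => c s w) G D.init) g τ w ∧
    ν < D.dist.real {u | τ < expectedCost (D.inst u) (fun s => c s w) G D.init}} with hbad
  have hbound : μK bad ≤ ENNReal.ofReal (confidence K (Fintype.card W) ν) :=
    measure_tieBroken_le (μ := D.dist) hA hA'
      (f := fun u w => expectedCost (D.inst u) (fun s => c s w) G D.init)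
      (fun w => D.measurable_expectedCost hG _ _)
      (fun u => (D.reachesSurely hG u).convexOn_expectedCost c D.init) hg
      -- Helly's theorem would allow `d = W + 1`; the larger value matches the number of terms in
      -- `confidence`.
      (d := Fintype.card W + 2) (by rw [Module.finrank_fintype_fun_eq_card]; omega) hK hν.1 hν.2.le
  have hconf : 0 ≤ confidence K (Fintype.card W) ν :=
    Finset.sum_nonneg fun i _ => mul_nonneg (mul_nonneg (Nat.cast_nonneg _)
      (pow_nonneg (sub_nonneg.2 hν.2.le) _)) (pow_nonneg hν.1 _)
  -- The bad set is not shown to be measurable, so its measurable hull, of equal measure, is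
  -- removed.
  refine ⟨(toMeasurable μK bad)ᶜ, (measurableSet_toMeasurable _ _).compl, ?_,
    fun ω hω w hsol _ => ?_⟩
  · rw [measureReal_compl (measurableSet_toMeasurable _ _), probReal_univ]
    refine sub_le_sub_left ?_ 1
    rw [measureReal_def, measure_toMeasurable]
    exact ENNReal.toReal_le_of_le_ofReal hconf hbound
  · obtain ⟨⟨τ, x, hopt⟩, htie⟩ := hsol
    obtain ⟨hτκ, hmm⟩ := hopt.isTieBrokenMinMax D hG htie
    have hnot : ω ∉ bad := fun h => hω (subset_toMeasurable _ _ h)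
    have hle : D.dist.real {u | τ < expectedCost (D.inst u) (fun s => c s w) G D.init} ≤ ν := by
      by_contra! hlt
      exact hnot ⟨τ, w, hmm, hlt⟩
    rw [D.satProb_eq hG]
    refine sub_le_sub_left (le_trans (measureReal_mono fun u hu => ?_) hle) 1
    exact lt_of_le_of_lt hτκ hu
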